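/- Let $F'/F$ be a field extension which is separable, i.e. the ring $\overline{F}\otimes_F F'$ has no nonzero nilpotent elements, where $\overline F$ is an algebraic closure of $F$ ($F'/F$ need not be algebraic). Let $\mathcal{A}$ be an $F$-finite $F$-linear abelian category, i.e. all objects of $\mathcal A$ have finite length and all endomorphism algebras are finite-dimensional over $F$. Let $\mathcal{A}\otimes_F F'$ be the full subcategory of all objects of finite length in the $F'$-linear category $(\mathrm{ind}\,\mathcal A)_{F'}$ of $F'$-modules in ind-objects of $\mathcal A$; the objects of the latter are pairs $(X,\phi)$ of an ind-object $X$ of $\mathcal A$ and a homomorphism of $F$-algebras $\phi:F'\to\mathrm{End}(X)$, and its morphisms are the morphisms of ind-objects commuting with the actions of $F'$. Let $t$ be the $F$-linear functor from $\mathcal A$ to $(\mathrm{ind}\,\mathcal A)_{F'}$, $X\mapsto F'\otimes_F X$, where $F'\otimes_FX$ is the ind-object with $\mathrm{Hom}(Y,F'\otimes_F X)=F'\otimes_F\mathrm{Hom}(Y,X)$ for $Y\in\mathcal A$, on which $F'$ acts by multiplication on the first factor. Let $\mathcal B$ be an $F'$-linear abelian category, and let $V:\mathcal A\to\mathcal B$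 be a right exact $F$-linear functor. Then $t$ takes values in $\mathcal A\otimes_FF'$, and if $V':\mathcal A\otimes_F F'\to\mathcal B$ is the right exact $F'$-linear functor induced by $V$, i.e. any right exact $F'$-linear functor with $V\cong V'\circ t$, then $V$ is semisimple on objects if and only if $V'$ is semisimple on objects. Here an object of an abelian category is called semisimple if it is the sum of its simple subobjects (i.e. no proper subobject contains all simple subobjects), and a functor between abelian categories is called semisimple on objects if it maps semisimple objects to semisimple objects. -/

import Mathlib

open CategoryTheory CategoryTheory.Limits Opposite

open scoped TensorProduct

universe v u v₁ u₁

noncomputable section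

namespace ScalarExt

/-! ### Finiteness and semisimplicity -/

/-- An object has finite length if its subobjects satisfy both chain conditions. -/
def HasFiniteLength {C : Type u} [Category.{v} C] (X : C) : Prop :=
  IsNoetherianObject X ∧ IsArtinianObject X

/-- An `F`-linear category is `F`-finite if all objects have finite length and all
endomorphism algebras are finite-dimensional over `F`. -/
def IsFieldFinite (F : Type u₁) [Field F] (C : Type u) [Category.{v} C] [Preadditive C]
    [Linear F C] : Prop :=
  ∀ X : C, HasFiniteLength X ∧ FiniteDimensional F (End X)

/-- An object is semisimple if it is the sum of its simple subobjects, that is, if the only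
subobject containing all simple subobjects is the whole object. -/
def IsSemisimpleObject {C : Type u} [Category.{v} C] [HasZeroMorphisms C] (X : C) : Prop :=
  ∀ Y : Subobject X, (∀ S : Subobject X, Simple (S : C) → S ≤ Y) → Y = ⊤

/-- A functor is semisimple on objects if it maps semisimple objects to semisimple objects. -/
def IsSemisimpleOnObjects {C : Type u} [Category.{v} C] [HasZeroMorphisms C]
    {D : Type u₁} [Category.{v₁} D] [HasZeroMorphisms D] (V : C ⥤ D) : Prop :=
  ∀ X : C, IsSemisimpleObject X → IsSemisimpleObject (V.obj X)

/-- A (not necessarily algebraic) field extension `F'/F` is separable if `F̄ ⊗ F'` has no nonzero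
nilpotent elements, where `F̄` is an algebraic closure of `F`. -/
def IsSeparableExtension (F : Type u) (F' : Type u₁) [Field F] [Field F'] [Algebra F F'] : Prop :=
  IsReduced (AlgebraicClosure F ⊗[F] F')

/-- A functor from an `F`-linear category to an `F'`-linear category is `F`-linear if it is
additive and compatible with scalar multiplication by elements of `F`. -/
structure IsLinearOver (F : Type u) (F' : Type u₁) [Field F] [Field F'] [Algebra F F']
    {C : Type*} [Category* C] [Preadditive C] [Linear F C]
    {D : Type*} [Category* D] [Preadditive D] [Linear F' D] (V : C ⥤ D) : Prop where
  map_add : ∀ (X Y : C) (f g : X ⟶ Y), V.map (f + g) = V.map f + V.map g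
  map_smul : ∀ (X Y : C) (c : F) (f : X ⟶ Y), V.map (c • f) = algebraMap F F' c • V.map f

/-! ### Ind-objects of a linear category -/

section

variable (F : Type v) [Field F] (A : Type u) [Category.{v} A] [Abelian A] [Linear F A]

/-- An `F`-linear presheaf of `F`-vector spaces whose underlying presheaf of sets is an
ind-object, i.e. a small filtered colimit of representable presheaves. The `F`-vector space
structure on the values of an ind-object `P` is uniquely determined by `F`-linearity of `P`. -/
def isLinearInd : ObjectProperty (Aᵒᵖ ⥤ ModuleCat.{v} F) := fun P =>
  (∀ (X Y : A) (f g : X ⟶ Y), P.map (f + g).op = P.map f.op + P.map g.op) ∧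
  (∀ (X Y : A) (c : F) (f : X ⟶ Y), P.map (c • f).op = c • P.map f.op) ∧
  IsIndObject (P ⋙ forget (ModuleCat.{v} F))

/-- The `F`-linear category of ind-objects of the `F`-linear abelian category `A`. -/
abbrev LinearInd := (isLinearInd F A).FullSubcategory

end

/-! ### Modules over an extension field in the category of ind-objects -/

section

variable (F F' : Type v) [Field F] [Field F'] [Algebra F F']
  (A : Type u) [Category.{v} A] [Abelian A] [Linear F A]

/-- An `F'`-module in the category of ind-objects of `A`. -/
structure IndModule where
  /-- the underlying ind-object -/
  obj : LinearInd F A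
  /-- the action of the extension field -/
  act : F' →ₐ[F] End obj

namespace IndModule

variable {F F' A}

/-- A homomorphism of `F'`-modules is a homomorphism of ind-objects commuting with the actions
of `F'`. -/
@[ext]
structure Hom (M N : IndModule F F' A) where
  /-- the underlying homomorphism of ind-objects -/
  hom : M.obj ⟶ N.obj
  comm : ∀ c : F', M.act c ≫ hom = hom ≫ N.act c

instance : Category (IndModule F F' A) where
  Hom := Hom
  id M := ⟨𝟙 _, fun c => by simp⟩
  comp f g := ⟨f.hom ≫ g.hom, fun c => by
    rw [← Category.assoc, f.comm, Category.assoc, g.comm, Category.assoc]⟩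

@[simp] theorem id_hom (M : IndModule F F' A) : Hom.hom (𝟙 M) = 𝟙 M.obj := rfl

@[simp] theorem comp_hom {M N K : IndModule F F' A} (f : M ⟶ N) (g : N ⟶ K) :
    Hom.hom (f ≫ g) = Hom.hom f ≫ Hom.hom g := rfl

@[ext] theorem hom_ext {M N : IndModule F F' A} {f g : M ⟶ N} (h : Hom.hom f = Hom.hom g) :
    f = g := Hom.ext h

section

variable (M N : IndModule F F' A)

instance : Zero (M ⟶ N) := ⟨⟨0, fun c => by simp⟩⟩
instance : Add (M ⟶ N) := ⟨fun f g => ⟨f.hom + g.hom, fun c => by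
  rw [Preadditive.comp_add, Preadditive.add_comp, f.comm, g.comm]⟩⟩
instance : Neg (M ⟶ N) := ⟨fun f => ⟨-f.hom, fun c => by
  rw [Preadditive.comp_neg, Preadditive.neg_comp, f.comm]⟩⟩

theorem act_comm (M : IndModule F F' A) (c d : F') :
    M.act c ≫ M.act d = M.act d ≫ M.act c := by
  change M.act d * M.act c = M.act c * M.act d
  rw [← map_mul, ← map_mul, mul_comm]

/-- `c • f` is `f` followed by the action of `c` on the target. -/
instance : SMul F' (M ⟶ N) := ⟨fun c f => ⟨f.hom ≫ N.act c, fun d => by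
  rw [← Category.assoc, f.comm, Category.assoc, Category.assoc, act_comm]⟩⟩

variable {M N}

@[simp] theorem zero_hom : Hom.hom (0 : M ⟶ N) = 0 := rfl
@[simp] theorem add_hom (f g : M ⟶ N) : Hom.hom (f + g) = Hom.hom f + Hom.hom g := rfl
@[simp] theorem neg_hom (f : M ⟶ N) : Hom.hom (-f) = -Hom.hom f := rfl
@[simp] theorem smul_hom (c : F') (f : M ⟶ N) : Hom.hom (c • f) = Hom.hom f ≫ N.act c := rfl

end

instance (M N : IndModule F F' A) : AddCommGroup (M ⟶ N) where
  add_assoc _ _ _ := by ext1; simp [add_assoc]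
  zero_add _ := by ext1; simp
  add_zero _ := by ext1; simp
  neg_add_cancel _ := by ext1; simp
  add_comm _ _ := by ext1; simp [add_comm]
  nsmul := nsmulRec
  zsmul := zsmulRec

instance : Preadditive (IndModule F F' A) where
  add_comp _ _ _ _ _ _ := by ext1; simp
  comp_add _ _ _ _ _ _ := by ext1; simp

instance (M N : IndModule F F' A) : Module F' (M ⟶ N) where
  one_smul f := by
    ext1; rw [smul_hom, map_one]; exact Category.comp_id _
  mul_smul c d f := by
    ext1; rw [smul_hom, smul_hom, smul_hom, map_mul, Category.assoc]; rfl
  smul_zero c := by ext1; simp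
  smul_add c f g := by ext1; simp
  add_smul c d f := by
    ext1; rw [smul_hom, map_add]; exact Preadditive.comp_add _ _ _ _ _ _
  zero_smul f := by
    ext1; rw [smul_hom, map_zero]; exact comp_zero

instance : Linear F' (IndModule F F' A) where
  smul_comp _ _ _ c f g := by
    ext1; rw [comp_hom, smul_hom, smul_hom, comp_hom, Category.assoc, g.comm, Category.assoc]
  comp_smul _ _ _ f c g := by
    ext1; rw [comp_hom, smul_hom, smul_hom, comp_hom, Category.assoc]

end IndModule

/-- The scalar extension of `A` from `F` to `F'`: the full subcategory of the category of
`F'`-modules in ind-objects of `A` formed by the objects of finite length. -/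
abbrev ScalarExtension :=
  ObjectProperty.FullSubcategory (fun M : IndModule F F' A => HasFiniteLength M)

end

/-! ### The functor `X ↦ F' ⊗ X` -/

section

variable (F F' : Type v) [Field F] [Field F'] [Algebra F F']
  {A : Type u} [Category.{v} A] [Abelian A] [Linear F A]

/-- The presheaf `Y ↦ F' ⊗ Hom(Y, X)`; for a basis of `F'` over `F`, it is the direct sum in
ind-objects of copies of `X` indexed by the basis. -/
def extPresheaf (X : A) : Aᵒᵖ ⥤ ModuleCat.{v} F where
  obj Y := ModuleCat.of F (F' ⊗[F] (Y.unop ⟶ X))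
  map f := ModuleCat.ofHom ((Linear.leftComp F X f.unop).lTensor F')
  map_id Y := by
    have : Linear.leftComp F X (𝟙 Y.unop) = LinearMap.id := by ext; simp
    ext1
    simp [this]
  map_comp f g := by
    have : Linear.leftComp F X (g.unop ≫ f.unop) =
        (Linear.leftComp F X g.unop).comp (Linear.leftComp F X f.unop) := by ext; simp
    ext1
    simp [this, LinearMap.lTensor_comp]

/-- Pullback of an element of `F' ⊗ Hom(Z, X)` along a morphism `Y ⟶ Z`. -/
abbrev pull (X : A) {Y Z : A} (f : Y ⟶ Z) : (F' ⊗[F] (Z ⟶ X)) →ₗ[F] (F' ⊗[F] (Y ⟶ X)) :=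
  (Linear.leftComp F X f).lTensor F'

theorem pull_comp (X : A) {Y Z W : A} (f : Y ⟶ Z) (g : Z ⟶ W) (w : F' ⊗[F] (W ⟶ X)) :
    pull F F' X (f ≫ g) w = pull F F' X f (pull F F' X g w) := by
  have : Linear.leftComp F X (f ≫ g) =
      (Linear.leftComp F X f).comp (Linear.leftComp F X g) := by ext; simp
  simp [pull, this, LinearMap.lTensor_comp]

theorem pull_id (X : A) {Y : A} (w : F' ⊗[F] (Y ⟶ X)) : pull F F' X (𝟙 Y) w = w := by
  have : Linear.leftComp F X (𝟙 Y) = LinearMap.id := by ext; simp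
  simp [pull, this]

theorem pull_zero (X : A) {Y Z : A} (w : F' ⊗[F] (Z ⟶ X)) :
    pull F F' X (0 : Y ⟶ Z) w = 0 := by
  have : Linear.leftComp F X (0 : Y ⟶ Z) = 0 := by ext; simp
  simp [pull, this]

theorem pull_sub (X : A) {Y Z : A} (f g : Y ⟶ Z) (w : F' ⊗[F] (Z ⟶ X)) :
    pull F F' X (f - g) w = pull F F' X f w - pull F F' X g w := by
  have : Linear.leftComp F X (f - g) = Linear.leftComp F X f - Linear.leftComp F X g := by
    ext; simp
  simp [pull, this, LinearMap.lTensor_sub]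

theorem exists_pull_cokernel (X : A) {Y Z : A} (d : Y ⟶ Z) (y : F' ⊗[F] (Z ⟶ X))
    (hy : pull F F' X d y = 0) : ∃ w, pull F F' X (cokernel.π d) w = y := by
  have hex : Function.Exact (Linear.leftComp F X (cokernel.π d)) (Linear.leftComp F X d) := by
    intro g
    constructor
    · intro hg
      exact ⟨cokernel.desc d g hg, cokernel.π_desc d g hg⟩
    · rintro ⟨h, rfl⟩
      simp
  exact (Module.Flat.lTensor_exact F' hex y).1 hy

attribute [local instance] Abelian.hasFiniteBiproducts

theorem exists_pull_biproduct (X : A) {Y : A} (x : F' ⊗[F] (Y ⟶ X)) :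
    ∃ (n : ℕ) (w : F' ⊗[F] ((⨁ fun _ : Fin n => X) ⟶ X)) (f : Y ⟶ ⨁ fun _ : Fin n => X),
      pull F F' X f w = x := by
  obtain ⟨s, rfl⟩ := TensorProduct.exists_finset x
  refine ⟨s.card, ∑ i, (s.equivFin.symm i).1.1 ⊗ₜ[F] biproduct.π (fun _ : Fin s.card => X) i,
    biproduct.lift fun i => (s.equivFin.symm i).1.2, ?_⟩
  simp only [map_sum, LinearMap.lTensor_tmul, Linear.leftComp_apply, biproduct.lift_π]
  rw [Equiv.sum_comp s.equivFin.symm (fun i => i.1.1 ⊗ₜ[F] i.1.2)]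
  exact Finset.sum_coe_sort s (fun i => i.1 ⊗ₜ[F] i.2)

/-- The object of the category of elements of `Y ↦ F' ⊗ Hom(Y, X)` given by an element. -/
abbrev elt (X : A) (Y : A) (x : F' ⊗[F] (Y ⟶ X)) :
    CostructuredArrow yoneda (extPresheaf F F' X ⋙ forget (ModuleCat.{v} F)) :=
  CostructuredArrow.mk (Y := Y) (yonedaEquiv.symm x)

theorem exists_eq_elt (X : A)
    (j : CostructuredArrow yoneda (extPresheaf F F' X ⋙ forget (ModuleCat.{v} F))) :
    ∃ Y x, j = elt F F' X Y x := by
  refine ⟨j.left, yonedaEquiv j.hom, ?_⟩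
  conv_lhs => rw [CostructuredArrow.eq_mk j]
  exact congrArg CostructuredArrow.mk (yonedaEquiv.symm_apply_apply j.hom).symm

theorem elt_hom (X : A) {Y Z : A} {x : F' ⊗[F] (Y ⟶ X)} {z : F' ⊗[F] (Z ⟶ X)}
    (f : elt F F' X Y x ⟶ elt F F' X Z z) : pull F F' X f.left z = x := by
  have := CostructuredArrow.w f
  apply_fun yonedaEquiv at this
  rw [← yonedaEquiv_naturality] at this
  erw [Equiv.apply_symm_apply, Equiv.apply_symm_apply] at this
  exact this

/-- A morphism in the category of elements. -/
def eltHom (X : A) {Y Z : A} {x : F' ⊗[F] (Y ⟶ X)} {z : F' ⊗[F] (Z ⟶ X)}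
    (f : Y ⟶ Z) (h : pull F F' X f z = x) : elt F F' X Y x ⟶ elt F F' X Z z :=
  CostructuredArrow.homMk f (by
    apply yonedaEquiv.injective
    rw [← yonedaEquiv_naturality]
    erw [Equiv.apply_symm_apply, Equiv.apply_symm_apply]
    exact h)

theorem isIndObject_extPresheaf (X : A) :
    IsIndObject (extPresheaf F F' X ⋙ forget (ModuleCat.{v} F)) := by
  have h₁ : IsFiltered
      (CostructuredArrow yoneda (extPresheaf F F' X ⋙ forget (ModuleCat.{v} F))) :=
    { nonempty := ⟨elt F F' X X 0⟩
      cocone_objs := by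
        intro j j'
        obtain ⟨Y, x, rfl⟩ := exists_eq_elt F F' X j
        obtain ⟨Z, z, rfl⟩ := exists_eq_elt F F' X j'
        refine ⟨elt F F' X (Y ⊞ Z) (pull F F' X biprod.fst x + pull F F' X biprod.snd z),
          eltHom F F' X biprod.inl ?_, eltHom F F' X biprod.inr ?_, trivial⟩
        · rw [map_add, ← pull_comp, ← pull_comp, biprod.inl_fst, biprod.inl_snd, pull_id,
            pull_zero, add_zero]
        · rw [map_add, ← pull_comp, ← pull_comp, biprod.inr_fst, biprod.inr_snd, pull_id,
            pull_zero, zero_add]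
      cocone_maps := by
        intro j j' f g
        obtain ⟨Y, x, rfl⟩ := exists_eq_elt F F' X j
        obtain ⟨Z, z, rfl⟩ := exists_eq_elt F F' X j'
        have hf := elt_hom F F' X f
        have hg := elt_hom F F' X g
        obtain ⟨w, hw⟩ := exists_pull_cokernel F F' X (f.left - g.left) z (by
          rw [pull_sub, hf, hg, sub_self])
        refine ⟨elt F F' X _ w, eltHom F F' X (cokernel.π (f.left - g.left)) hw, ?_⟩
        ext
        have := cokernel.condition (f.left - g.left)
        rw [Preadditive.sub_comp, sub_eq_zero] at this
        exact this }
  have h₂ : FinallySmall.{v}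
      (CostructuredArrow yoneda (extPresheaf F F' X ⋙ forget (ModuleCat.{v} F))) := by
    refine finallySmall_of_small_weakly_terminal_set (Set.range
      (fun p : Σ n : ℕ, F' ⊗[F] ((⨁ fun _ : Fin n => X) ⟶ X) => elt F F' X _ p.2)) ?_
    intro j
    obtain ⟨Y, x, rfl⟩ := exists_eq_elt F F' X j
    obtain ⟨n, w, f, hf⟩ := exists_pull_biproduct F F' X x
    exact ⟨_, ⟨⟨n, w⟩, rfl⟩, ⟨eltHom F F' X f hf⟩⟩
  exact isIndObject_of_isFiltered_of_finallySmall _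

theorem isLinearInd_extPresheaf (X : A) : isLinearInd F A (extPresheaf F F' X) := by
  have hadd : ∀ (Y Z : A) (f g : Y ⟶ Z), (extPresheaf F F' X).map (f + g).op =
      (extPresheaf F F' X).map f.op + (extPresheaf F F' X).map g.op := by
    intro Y Z f g
    have : Linear.leftComp F X (f + g) = Linear.leftComp F X f + Linear.leftComp F X g := by
      ext; simp
    ext1
    simp only [extPresheaf, Quiver.Hom.unop_op, this, LinearMap.lTensor_add]
    rfl
  refine ⟨hadd, ?_, ?_⟩
  · intro Y Z c f
    have : Linear.leftComp F X (c • f) = c • Linear.leftComp F X f := by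
      ext; simp
    ext1
    simp only [extPresheaf, Quiver.Hom.unop_op, this, LinearMap.lTensor_smul]
    rfl
  · exact isIndObject_extPresheaf F F' X

/-- The ind-object `F' ⊗ X`. -/
abbrev extObj (X : A) : LinearInd F A := ⟨extPresheaf F F' X, isLinearInd_extPresheaf F F' X⟩

theorem end_ext {X : A} {a b : extObj F F' X ⟶ extObj F F' X}
    (h : ∀ Y, a.hom.app Y = b.hom.app Y) : a = b :=
  ObjectProperty.hom_ext _ (NatTrans.ext (funext h))

theorem lTensor_rTensor_comm {M N : Type v} [AddCommGroup M] [AddCommGroup N] [Module F M]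
    [Module F N] (g : F' →ₗ[F] F') (f : M →ₗ[F] N) :
    (g.rTensor N).comp (f.lTensor F') = (f.lTensor F').comp (g.rTensor M) := by
  rw [LinearMap.rTensor_comp_lTensor, LinearMap.lTensor_comp_rTensor]

/-- Multiplication by `c` on the first factor of `F' ⊗ X`. -/
def extAct (X : A) (c : F') : End (extObj F F' X) :=
  ObjectProperty.homMk
    { app := fun Y => ModuleCat.ofHom ((LinearMap.mulLeft F c).rTensor (Y.unop ⟶ X))
      naturality := fun Y Z f => by
        ext1
        exact lTensor_rTensor_comm F F' _ _ }

theorem extAct_app (X : A) (c : F') (Y : Aᵒᵖ) :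
    (extAct F F' X c).hom.app Y =
      ModuleCat.ofHom ((LinearMap.mulLeft F c).rTensor (Y.unop ⟶ X)) := rfl

/-- The functor `t` from `A` to `F'`-modules in ind-objects of `A`, which maps `X` to `F' ⊗ X`
with the action of `F'` by multiplication on the first factor. -/
def extFunctor : A ⥤ IndModule F F' A where
  obj X :=
    { obj := extObj F F' X
      act := AlgHom.ofLinearMap
        { toFun := extAct F F' X
          map_add' := fun c d => by
            have : LinearMap.mulLeft F (c + d) = LinearMap.mulLeft F c + LinearMap.mulLeft F d := by
              ext; simp [add_mul]
            refine end_ext F F' fun Y => ?_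
            rw [extAct_app, this, LinearMap.rTensor_add]
            rfl
          map_smul' := fun c d => by
            have : LinearMap.mulLeft F (c • d) = c • LinearMap.mulLeft F d := by
              ext; simp
            refine end_ext F F' fun Y => ?_
            rw [extAct_app, this, LinearMap.rTensor_smul]
            rfl }
        (by
          have : LinearMap.mulLeft F (1 : F') = LinearMap.id := by ext; simp
          refine end_ext F F' fun Y => ?_
          change (extAct F F' X 1).hom.app Y = _
          rw [extAct_app, this, LinearMap.rTensor_id]
          rfl)
        (fun c d => by
          have : LinearMap.mulLeft F (c * d) =
              (LinearMap.mulLeft F c).comp (LinearMap.mulLeft F d) := by ext; simp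
          refine end_ext F F' fun Y => ?_
          change (extAct F F' X (c * d)).hom.app Y = _
          rw [extAct_app, this, LinearMap.rTensor_comp]
          rfl) }
  map {X X'} g :=
    { hom := ObjectProperty.homMk
        { app := fun Y => ModuleCat.ofHom ((Linear.rightComp F Y.unop g).lTensor F')
          naturality := fun Y Z f => by
            have : (Linear.rightComp F Z.unop g).comp (Linear.leftComp F X f.unop) =
                (Linear.leftComp F X' f.unop).comp (Linear.rightComp F Y.unop g) := by
              ext; simp
            ext1
            exact (LinearMap.lTensor_comp _ _ _).symm.trans
              ((congrArg (LinearMap.lTensor F') this).trans (LinearMap.lTensor_comp _ _ _)) }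
      comm := fun c => by
        ext Y : 4
        exact (lTensor_rTensor_comm F F' _ _).symm }
  map_id X := by
    ext Y : 5
    have : Linear.rightComp F Y.unop (𝟙 X) = LinearMap.id := by ext; simp
    exact (congrArg (LinearMap.lTensor F') this).trans (LinearMap.lTensor_id _ _)
  map_comp {X X' X''} g h := by
    ext Y : 5
    have : Linear.rightComp F Y.unop (g ≫ h) =
        (Linear.rightComp F Y.unop h).comp (Linear.rightComp F Y.unop g) := by ext; simp
    exact (congrArg (LinearMap.lTensor F') this).trans (LinearMap.lTensor_comp _ _ _)

/-- The functor `t : A ⥤ A ⊗ F'`, once it is known that all `F' ⊗ X` have finite length. -/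
def toScalarExtension (ht : ∀ X : A, HasFiniteLength ((extFunctor F F').obj X)) :
    A ⥤ ScalarExtension F F' A :=
  ObjectProperty.lift _ (extFunctor F F') ht

end

end ScalarExt

end

noncomputable section

namespace ScalarExt

/-! ### Semisimplicity of scalar extensions of division algebras -/

section Algebra

/-! Both implications transport semisimplicity along epimorphisms: in an abelian category, quotients
of semisimple objects are semisimple (`IsSemisimpleObject.of_epi`), and `V` agrees with `V'` on the
objects `F' ⊗ X`.

If `V` is semisimple on objects and `M` is semisimple in the scalar extension, some semisimple `X`
in `A` admits an epimorphism `F' ⊗ X ⟶ M` (`exists_epi_of_isSemisimpleObject`). By Yoneda such a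
morphism is a section of `M` over `X`; a simple `M` has a nonzero section over a simple object, and
it generates `M`. Since `V'` preserves epimorphisms, `V' M` is a quotient of `V X`.

Conversely it is enough that `F' ⊗ X` is semisimple for semisimple `X`
(`isSemisimpleObject_toScalarExtension`); separability enters only here. For simple `S`, Schur's
lemma makes `End S` a division algebra, and `F' ⊗ End S` is a semisimple ring
(`isSemisimpleRing_tensorProduct`). A subobject of `F' ⊗ S` is determined by its sections over `S`,
a right ideal of this ring (`ClosedSub.le_of_rightIdeal_le`), and each minimal right ideal comes
from a simple subobject. The same control of subobjects bounds the length of `F' ⊗ S` by the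
dimension of `End S`, and extensions give finite length of `F' ⊗ X` in general.

The scalar extension is not treated as an abelian category. Kernels and binary products of
ind-modules are built on sections, and monomorphisms are recognized as sectionwise injections by
testing on the objects `F' ⊗ Y`. -/

theorem isReduced_tensorProduct_of_isSeparableExtension {F : Type u} {F' : Type u₁} [Field F]
    [Field F'] [Algebra F F'] (h : IsSeparableExtension F F') (K : Type*) [CommRing K]
    [IsDomain K] [Algebra F K] [Algebra.IsIntegral F K] : IsReduced (F' ⊗[F] K) := by
  have : IsReduced (AlgebraicClosure F ⊗[F] F') := h
  -- A domain integral over a field is a field, so it embeds into `AlgebraicClosure F`; flatness of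
  -- `F'` keeps the embedding injective after tensoring.
  let : Field K := (isField_of_isIntegral_of_isField' (R := F) (Field.toIsField F)).toField
  let φ : K →ₐ[F] AlgebraicClosure F := IsAlgClosed.lift
  let ψ : F' ⊗[F] K →ₐ[F] AlgebraicClosure F ⊗[F] F' :=
    (Algebra.TensorProduct.comm F F' (AlgebraicClosure F)).toAlgHom.comp
      (Algebra.TensorProduct.map (AlgHom.id F F') φ)
  refine isReduced_of_injective ψ ?_
  refine (Algebra.TensorProduct.comm F F' (AlgebraicClosure F)).injective.comp ?_
  exact Module.Flat.lTensor_preserves_injective_linearMap (M := F') φ.toLinearMap φ.injective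

variable {F F' D : Type*} [Field F] [Field F'] [Algebra F F'] [DivisionRing D] [Algebra F D]

/-- Shortest-element argument: in a basis of `F'`, a nonzero element of `J` of minimal support with
one coefficient equal to `1` commutes with every `1 ⊗ a`, so all its coefficients are central. -/
theorem exists_mem_ideal_mem_range_center (J : Ideal (F' ⊗[F] D)) [J.IsTwoSided] (hJ : J ≠ ⊥) :
    ∃ y : F' ⊗[F] Subalgebra.center F D, y ≠ 0 ∧
      Algebra.TensorProduct.map (AlgHom.id F F') (Subalgebra.center F D).val y ∈ J := by
  classical
  let b := Module.Basis.ofVectorSpace F F'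
  let e := TensorProduct.equivFinsuppOfBasisLeft (N := D) b
  have el (a : D) (x : F' ⊗[F] D) (i) : e ((1 ⊗ₜ[F] a) * x) i = a * e x i := by
    induction x with
    | zero => simp
    | add x y hx hy => simp [mul_add, hx, hy]
    | tmul c d => simp [e]
  have er (a : D) (x : F' ⊗[F] D) (i) : e (x * (1 ⊗ₜ[F] a)) i = e x i * a := by
    induction x with
    | zero => simp
    | add x y hx hy => simp [add_mul, hx, hy]
    | tmul c d => simp [e]
  obtain ⟨x₀, hx₀, hx₀'⟩ := J.ne_bot_iff.1 hJ
  obtain ⟨x, ⟨hxJ, hx0⟩, hmin⟩ := WellFounded.has_min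
    (measure fun x : F' ⊗[F] D => (e x).support.card).wf {x | x ∈ J ∧ x ≠ 0} ⟨x₀, hx₀, hx₀'⟩
  obtain ⟨i₀, hi₀⟩ : ∃ i, e x i ≠ 0 := by
    by_contra! h
    exact hx0 (e.injective (by ext i; simp [h i]))
  let y := (1 ⊗ₜ[F] (e x i₀)⁻¹) * x
  have hyJ : y ∈ J := J.mul_mem_left _ hxJ
  have hy₀ : e y i₀ = 1 := by rw [el, inv_mul_cancel₀ hi₀]
  have hc (a : D) (i) : a * e y i = e y i * a := by
    have hz : (1 ⊗ₜ[F] a) * y - y * (1 ⊗ₜ[F] a) = 0 := by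
      by_contra hz
      refine hmin _ ⟨J.sub_mem (J.mul_mem_left _ hyJ) (J.mul_mem_right _ hyJ), hz⟩ ?_
      -- The commutator is supported inside the support of `x` and loses the index `i₀`, where its
      -- coefficient is `a * 1 - 1 * a`.
      refine Finset.card_lt_card ⟨fun i hi => ?_, fun hsub => ?_⟩
      · rw [Finsupp.mem_support_iff] at hi ⊢
        contrapose! hi
        rw [map_sub, Finsupp.sub_apply, el, er, el, hi]
        simp
      · have := hsub (Finsupp.mem_support_iff.2 hi₀)
        rw [Finsupp.mem_support_iff, map_sub, Finsupp.sub_apply, el, er, hy₀] at this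
        simp at this
    have := congrArg (fun w => e w i) hz
    simpa only [map_sub, Finsupp.sub_apply, el, er, map_zero, Finsupp.zero_apply, sub_eq_zero]
      using this
  have hy : y = (e y).sum fun i d => b i ⊗ₜ d := by
    rw [← TensorProduct.equivFinsuppOfBasisLeft_symm_apply, LinearEquiv.symm_apply_apply]
  let w : F' ⊗[F] Subalgebra.center F D := ∑ i ∈ (e y).support,
    b i ⊗ₜ (⟨e y i, Subalgebra.mem_center_iff.2 fun a => hc a i⟩ : Subalgebra.center F D)
  have hw : Algebra.TensorProduct.map (AlgHom.id F F') (Subalgebra.center F D).val w = y := by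
    conv_rhs => rw [hy]
    simp [w, Finsupp.sum]
  refine ⟨w, ?_, hw ▸ hyJ⟩
  intro h0
  rw [h0, map_zero] at hw
  rw [← hw] at hy₀
  simp at hy₀

/-- The ring is Artinian, so its Jacobson radical is nilpotent. If it were nonzero it would contain
a nonzero element of `F' ⊗ Z(D)`, which is then nilpotent in a reduced ring. -/
theorem isSemisimpleRing_tensorProduct {F : Type u} {F' : Type u₁} [Field F]
    [Field F'] [Algebra F F'] (h : IsSeparableExtension F F') (D : Type*) [DivisionRing D]
    [Algebra F D] [FiniteDimensional F D] : IsSemisimpleRing (F' ⊗[F] D) := by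
  have : IsArtinianRing (F' ⊗[F] D) := isArtinian_of_tower F' inferInstance
  rw [IsArtinianRing.isSemisimpleRing_iff_jacobson]
  by_contra hJ
  obtain ⟨y, hy0, hyJ⟩ := exists_mem_ideal_mem_range_center _ hJ
  have : IsReduced (F' ⊗[F] Subalgebra.center F D) :=
    isReduced_tensorProduct_of_isSeparableExtension h _
  obtain ⟨n, hn⟩ := IsSemiprimaryRing.isNilpotent (R := F' ⊗[F] D)
  have hyn := Ideal.pow_mem_pow hyJ n
  rw [hn, ← map_pow] at hyn
  have hinj : Function.Injective
      (Algebra.TensorProduct.map (AlgHom.id F F') (Subalgebra.center F D).val) :=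
    Module.Flat.lTensor_preserves_injective_linearMap (M := F')
      (Subalgebra.center F D).val.toLinearMap Subtype.val_injective
  exact hy0 (IsNilpotent.eq_zero ⟨n, hinj (by simpa using hyn)⟩)

end Algebra

/-! ### Exactness of ind-objects -/

section

variable {F : Type v} [Field F] {A : Type u} [Category.{v} A] [Abelian A] [Linear F A]

theorem isLinearInd.map_zero {P : Aᵒᵖ ⥤ ModuleCat.{v} F} (hP : isLinearInd F A P) (Y Z : A) :
    P.map (0 : Y ⟶ Z).op = 0 := by
  simpa using hP.1 Y Z 0 0

/-- Two morphisms agreeing on an element of an ind-object are equalized by a further morphism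
carrying that element. -/
theorem isLinearInd.exists_coequalizing {P : Aᵒᵖ ⥤ ModuleCat.{v} F} (hP : isLinearInd F A P)
    {Y Z : A} (f g : Y ⟶ Z) (z : P.obj (op Z)) (h : P.map f.op z = P.map g.op z) :
    ∃ (W : A) (q : Z ⟶ W) (w : P.obj (op W)), P.map q.op w = z ∧ f ≫ q = g ≫ q := by
  have := hP.2.2.isFiltered
  let Q := P ⋙ forget (ModuleCat.{v} F)
  let e (Y : A) (y : P.obj (op Y)) : CostructuredArrow yoneda Q :=
    CostructuredArrow.mk (Y := Y) (yonedaEquiv.symm (y : Q.obj (op Y)))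
  have key : ∀ {Y Z : A} (f : Y ⟶ Z) (y : P.obj (op Y)) (z : P.obj (op Z)), P.map f.op z = y →
      ∃ φ : e Y y ⟶ e Z z, φ.left = f := by
    intro Y Z f y z h
    refine ⟨CostructuredArrow.homMk f ?_, rfl⟩
    apply yonedaEquiv.injective
    rw [← yonedaEquiv_naturality]
    erw [Equiv.apply_symm_apply, Equiv.apply_symm_apply]
    exact h
  obtain ⟨φ, hφ⟩ := key f _ z rfl
  obtain ⟨ψ, hψ⟩ := key g _ z h.symm
  -- The category of elements of an ind-object is filtered; the arrow coequalizing `φ` and `ψ` there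
  -- carries the required `q`.
  have hc := congrArg CommaMorphism.left (IsFiltered.coeq_condition φ ψ)
  change φ.left ≫ _ = ψ.left ≫ _ at hc
  rw [hφ, hψ] at hc
  refine ⟨_, (IsFiltered.coeqHom φ ψ).left, yonedaEquiv (IsFiltered.coeq φ ψ).hom, ?_, hc⟩
  have := CostructuredArrow.w (IsFiltered.coeqHom φ ψ)
  apply_fun yonedaEquiv at this
  rw [← yonedaEquiv_naturality] at this
  erw [Equiv.apply_symm_apply] at this
  exact this

/-- A section killed by `p` comes from one along some `q` with `p ≫ q = 0`, and then `q = 0`. With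
`isLinearInd.exists_map_eq` this is left exactness of ind-objects. -/
theorem isLinearInd.map_injective_of_epi {P : Aᵒᵖ ⥤ ModuleCat.{v} F} (hP : isLinearInd F A P)
    {Y Z : A} (p : Y ⟶ Z) [Epi p] : Function.Injective (P.map p.op) := by
  refine (injective_iff_map_eq_zero (P.map p.op).hom).2 fun z hz => ?_
  obtain ⟨W, q, w, rfl, h⟩ := hP.exists_coequalizing p 0 z (by
    rw [hP.map_zero]; exact hz)
  have : q = 0 := by rwa [zero_comp, ← cancel_epi p, comp_zero] at *
  rw [this, hP.map_zero]
  rfl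

/-- The section comes from one along some `q` vanishing on the kernel of `p`, and such a `q`
descends along `p`. -/
theorem isLinearInd.exists_map_eq {P : Aᵒᵖ ⥤ ModuleCat.{v} F} (hP : isLinearInd F A P)
    {Y Z : A} (p : Y ⟶ Z) [Epi p] (y : P.obj (op Y)) (h : P.map (kernel.ι p).op y = 0) :
    ∃ z, P.map p.op z = y := by
  obtain ⟨W, q, w, rfl, hq⟩ := hP.exists_coequalizing (kernel.ι p) 0 y (by
    rw [hP.map_zero]; exact h)
  rw [zero_comp] at hq
  refine ⟨P.map (Abelian.epiDesc p q hq).op w, ?_⟩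
  rw [← ModuleCat.comp_apply, ← P.map_comp, ← op_comp, Abelian.comp_epiDesc]

end

/-! ### Sections of modules in ind-objects -/

namespace IndModule

section

variable {F F' : Type v} [Field F] [Field F'] [Algebra F F']
  {A : Type u} [Category.{v} A] [Abelian A] [Linear F A]

/-- The sections of an ind-module over an object of the base category. -/
abbrev Sec (M : IndModule F F' A) (Y : A) : Type v := M.obj.obj.obj (op Y)

/-- Restriction of sections. -/
def res (M : IndModule F F' A) {Y Z : A} (f : Y ⟶ Z) : M.Sec Z →ₗ[F] M.Sec Y :=
  (M.obj.obj.map f.op).hom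

/-- The action of scalars on sections. -/
def scal (M : IndModule F F' A) (c : F') {Y : A} : M.Sec Y →ₗ[F] M.Sec Y :=
  ((M.act c).hom.app (op Y)).hom

/-- The action of a morphism on sections. -/
def app {M N : IndModule F F' A} (g : M ⟶ N) (Y : A) : M.Sec Y →ₗ[F] N.Sec Y :=
  ((Hom.hom g).hom.app (op Y)).hom

variable (M : IndModule F F' A) {N K : IndModule F F' A}

theorem res_comp {X Y Z : A} (f : X ⟶ Y) (g : Y ⟶ Z) (m : M.Sec Z) :
    M.res (f ≫ g) m = M.res f (M.res g m) := by
  simp [res]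

theorem res_id {X : A} (m : M.Sec X) : M.res (𝟙 X) m = m := by
  simp [res]

theorem res_add {X Y : A} (f g : X ⟶ Y) (m : M.Sec Y) :
    M.res (f + g) m = M.res f m + M.res g m :=
  congrArg (fun φ : M.obj.obj.obj (op Y) ⟶ M.obj.obj.obj (op X) => φ.hom m)
    (M.obj.property.1 X Y f g)

theorem res_smul {X Y : A} (c : F) (f : X ⟶ Y) (m : M.Sec Y) :
    M.res (c • f) m = c • M.res f m :=
  congrArg (fun φ : M.obj.obj.obj (op Y) ⟶ M.obj.obj.obj (op X) => φ.hom m)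
    (M.obj.property.2.1 X Y c f)

theorem res_zero {X Y : A} (m : M.Sec Y) : M.res (0 : X ⟶ Y) m = 0 := by
  simpa using M.res_add (0 : X ⟶ Y) 0 m

theorem res_injective {Y Z : A} (p : Y ⟶ Z) [Epi p] : Function.Injective (M.res p) :=
  M.obj.property.map_injective_of_epi p

theorem exists_res_eq {Y Z : A} (p : Y ⟶ Z) [Epi p] (y : M.Sec Y)
    (h : M.res (kernel.ι p) y = 0) : ∃ z, M.res p z = y :=
  M.obj.property.exists_map_eq p y h

theorem res_scal (c : F') {X Y : A} (f : X ⟶ Y) (m : M.Sec Y) :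
    M.res f (M.scal c m) = M.scal c (M.res f m) :=
  (congrArg (fun φ : M.obj.obj.obj (op Y) ⟶ M.obj.obj.obj (op X) => φ.hom m)
    ((M.act c).hom.naturality f.op)).symm

theorem scal_add (c d : F') {Y : A} (m : M.Sec Y) :
    M.scal (c + d) m = M.scal c m + M.scal d m := by
  simp only [scal, map_add]
  rfl

theorem scal_one {Y : A} (m : M.Sec Y) : M.scal 1 m = m := by
  simp only [scal, map_one]
  rfl

theorem scal_mul (c d : F') {Y : A} (m : M.Sec Y) :
    M.scal (c * d) m = M.scal c (M.scal d m) := by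
  simp only [scal, map_mul]
  rfl

theorem scal_smul (c : F) (d : F') {Y : A} (m : M.Sec Y) :
    M.scal (c • d) m = c • M.scal d m := by
  simp only [scal, map_smul]
  rfl

variable {M}

theorem app_res (g : M ⟶ N) {X Y : A} (f : X ⟶ Y) (m : M.Sec Y) :
    app g X (M.res f m) = N.res f (app g Y m) :=
  congrArg (fun φ : M.obj.obj.obj (op Y) ⟶ N.obj.obj.obj (op X) => φ.hom m)
    ((Hom.hom g).hom.naturality f.op)

theorem app_scal (g : M ⟶ N) (c : F') {Y : A} (m : M.Sec Y) :
    app g Y (M.scal c m) = N.scal c (app g Y m) :=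
  congrArg (fun φ : M.obj ⟶ N.obj => (φ.hom.app (op Y)).hom m) (g.comm c)

@[simp] theorem app_comp (g : M ⟶ N) (h : N ⟶ K) (Y : A) (m : M.Sec Y) :
    app (g ≫ h) Y m = app h Y (app g Y m) := rfl

@[simp] theorem app_add (g h : M ⟶ N) (Y : A) (m : M.Sec Y) :
    app (g + h) Y m = app g Y m + app h Y m := rfl

@[simp] theorem app_neg (g : M ⟶ N) (Y : A) (m : M.Sec Y) : app (-g) Y m = -app g Y m := rfl

@[simp] theorem app_zero (Y : A) (m : M.Sec Y) : app (0 : M ⟶ N) Y m = 0 := rfl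

@[simp] theorem app_sub (g h : M ⟶ N) (Y : A) (m : M.Sec Y) :
    app (g - h) Y m = app g Y m - app h Y m := by
  rw [sub_eq_add_neg, app_add, app_neg, sub_eq_add_neg]

theorem ext_app {g h : M ⟶ N} (H : ∀ (Y : A) (m : M.Sec Y), app g Y m = app h Y m) : g = h := by
  ext Y m
  exact H Y.unop m

/-- A morphism of ind-modules given on sections. -/
def homOfApp (φ : ∀ Y : A, M.Sec Y →ₗ[F] N.Sec Y)
    (hres : ∀ {X Y : A} (f : X ⟶ Y) (m : M.Sec Y), φ X (M.res f m) = N.res f (φ Y m))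
    (hscal : ∀ (c : F') (Y : A) (m : M.Sec Y), φ Y (M.scal c m) = N.scal c (φ Y m)) : M ⟶ N where
  hom := ObjectProperty.homMk
    { app := fun Y => ModuleCat.ofHom (φ Y.unop)
      naturality := fun _ _ f => by
        ext m
        exact hres f.unop m }
  comm c := by
    ext Y m
    exact hscal c Y.unop m

@[simp] theorem app_homOfApp (φ : ∀ Y : A, M.Sec Y →ₗ[F] N.Sec Y) (hres) (hscal) (Y : A)
    (m : M.Sec Y) : app (homOfApp (M := M) (N := N) φ hres hscal) Y m = φ Y m := rfl

/-- An element of an ind-object lies in the range of a monomorphism as soon as it does so after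
restriction along an epimorphism. -/
theorem mem_range_of_epi (g : N ⟶ M) (hg : ∀ Y, Function.Injective (app g Y)) {Y Z : A}
    (p : Z ⟶ Y) [Epi p] (m : M.Sec Y) (h : ∃ n, app g Z n = M.res p m) :
    ∃ n, app g Y n = m := by
  obtain ⟨n, hn⟩ := h
  -- On the kernel of `p` the image of `n` is zero, so `n` is zero there by injectivity and descends
  -- along `p`.
  obtain ⟨n', rfl⟩ := N.exists_res_eq p n (hg _ (by
    rw [app_res, hn, ← res_comp, kernel.condition, res_zero, map_zero]))
  refine ⟨n', M.res_injective p ?_⟩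
  rw [← app_res, hn]

/-- Factorization through a pointwise injective morphism. -/
theorem exists_factor (f : K ⟶ M) (g : N ⟶ M) (hg : ∀ Y, Function.Injective (app g Y))
    (h : ∀ Y m, ∃ n, app g Y n = app f Y m) : ∃ φ : K ⟶ N, φ ≫ g = f := by
  choose s hs using h
  refine ⟨homOfApp (fun Y => { toFun := s Y, map_add' := ?_, map_smul' := ?_ }) ?_ ?_, ?_⟩
  · intro x y
    apply hg
    rw [map_add, hs, hs, hs, map_add]
  · intro c x
    apply hg
    rw [RingHom.id_apply, map_smul, hs, hs, map_smul]
  · intro X Y f m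
    apply hg
    change app g X (s X _) = app g X (N.res _ (s Y m))
    rw [hs, app_res, app_res, hs]
  · intro c Y m
    apply hg
    change app g Y (s Y _) = app g Y (N.scal _ (s Y m))
    rw [hs, app_scal, app_scal, hs]
  · exact ext_app fun Y m => hs Y m

theorem isIso_of_bijective (g : N ⟶ M) (hg : ∀ Y, Function.Bijective (app g Y)) : IsIso g := by
  obtain ⟨φ, hφ⟩ := exists_factor (𝟙 M) g (fun Y => (hg Y).1) fun Y m => (hg Y).2 m
  refine ⟨φ, ext_app fun Y m => (hg Y).1 ?_, hφ⟩
  exact congrArg (fun ψ => app ψ Y (app g Y m)) hφ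

theorem mono_of_injective (g : N ⟶ M) (hg : ∀ Y, Function.Injective (app g Y)) : Mono g :=
  ⟨fun _ _ h => ext_app fun Y m => hg Y (congrArg (fun ψ => app ψ Y m) h)⟩

/-! ### Kernels and sums -/

/-- An ind-module given by a presheaf and an action of scalars on its sections. -/
def mkOfScal (P : Aᵒᵖ ⥤ ModuleCat.{v} F) (hP : IsIndObject (P ⋙ forget _))
    (hadd : ∀ (X Y : A) (f g : X ⟶ Y) (m : P.obj (op Y)),
      (P.map (f + g).op).hom m = (P.map f.op).hom m + (P.map g.op).hom m)
    (hsmul : ∀ (X Y : A) (c : F) (f : X ⟶ Y) (m : P.obj (op Y)),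
      (P.map (c • f).op).hom m = c • (P.map f.op).hom m)
    (s : F' → ∀ Y : A, P.obj (op Y) →ₗ[F] P.obj (op Y))
    (hres : ∀ c {X Y : A} (f : X ⟶ Y) m, s c X ((P.map f.op).hom m) = (P.map f.op).hom (s c Y m))
    (s_add : ∀ c d Y m, s (c + d) Y m = s c Y m + s d Y m)
    (s_smul : ∀ (c : F) d Y m, s (c • d) Y m = c • s d Y m)
    (s_one : ∀ Y m, s 1 Y m = m)
    (s_mul : ∀ c d Y m, s (c * d) Y m = s c Y (s d Y m)) : IndModule F F' A where
  obj := ⟨P, fun X Y f g => ModuleCat.hom_ext (LinearMap.ext (hadd X Y f g)),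
    fun X Y c f => ModuleCat.hom_ext (LinearMap.ext (hsmul X Y c f)), hP⟩
  act := AlgHom.ofLinearMap
    { toFun := fun c => ObjectProperty.homMk
        { app := fun Y => ModuleCat.ofHom (s c Y.unop)
          naturality := fun _ _ f => ModuleCat.hom_ext (LinearMap.ext fun m => hres c f.unop m) }
      map_add' := fun c d => ObjectProperty.hom_ext _ (NatTrans.ext (funext fun Y =>
        ModuleCat.hom_ext (LinearMap.ext fun m => s_add c d Y.unop m)))
      map_smul' := fun c d => ObjectProperty.hom_ext _ (NatTrans.ext (funext fun Y =>
        ModuleCat.hom_ext (LinearMap.ext fun m => s_smul c d Y.unop m))) }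
    (ObjectProperty.hom_ext _ (NatTrans.ext (funext fun Y =>
      ModuleCat.hom_ext (LinearMap.ext fun m => s_one Y.unop m))))
    (fun c d => ObjectProperty.hom_ext _ (NatTrans.ext (funext fun Y =>
      ModuleCat.hom_ext (LinearMap.ext fun m => s_mul c d Y.unop m))))

/-- The presheaf given by a family of submodules stable under restriction. -/
def subPresheaf (P : Aᵒᵖ ⥤ ModuleCat.{v} F) (S : ∀ Y, Submodule F (P.obj Y))
    (hS : ∀ {Y Z} (f : Y ⟶ Z), ∀ m ∈ S Y, P.map f m ∈ S Z) : Aᵒᵖ ⥤ ModuleCat.{v} F where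
  obj Y := ModuleCat.of F (S Y)
  map f := ModuleCat.ofHom ((P.map f).hom.restrict (hS f))
  map_id Y := by
    refine ModuleCat.hom_ext (LinearMap.ext fun m => Subtype.ext ?_)
    exact congrArg (fun φ => φ.hom m.1) (P.map_id Y)
  map_comp f g := by
    refine ModuleCat.hom_ext (LinearMap.ext fun m => Subtype.ext ?_)
    exact congrArg (fun φ => φ.hom m.1) (P.map_comp f g)

/-- The kernel of a morphism of presheaves, computed on sections. -/
def kerPresheaf {P Q : Aᵒᵖ ⥤ ModuleCat.{v} F} (g : P ⟶ Q) : Aᵒᵖ ⥤ ModuleCat.{v} F :=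
  subPresheaf P (fun Y => LinearMap.ker (g.app Y).hom) fun {Y _} f m hm => by
    have := congrArg (fun φ => φ.hom m) (g.naturality f)
    have hm' : (g.app Y).hom m = 0 := hm
    exact this.trans ((congrArg (Q.map f).hom hm').trans (map_zero _))

-- On underlying sets this is the equalizer of `g` and `0`, and ind-objects are closed under
-- equalizers.
omit [Linear F A] in
theorem isIndObject_kerPresheaf {P Q : Aᵒᵖ ⥤ ModuleCat.{v} F} (g : P ⟶ Q)
    (hP : IsIndObject (P ⋙ forget _)) (hQ : IsIndObject (Q ⋙ forget _)) :
    IsIndObject (kerPresheaf g ⋙ forget (ModuleCat.{v} F)) := by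
  let P' := P ⋙ forget (ModuleCat.{v} F)
  let Q' := Q ⋙ forget (ModuleCat.{v} F)
  let K' := kerPresheaf g ⋙ forget (ModuleCat.{v} F)
  let g₁ : P' ⟶ Q' := Functor.whiskerRight g _
  let g₂ : P' ⟶ Q' := Functor.whiskerRight (0 : P ⟶ Q) _
  let ι : K' ⟶ P' :=
    { app := fun Y => TypeCat.ofHom fun x : LinearMap.ker (g.app Y).hom => (x.1 : P.obj Y)
      naturality := fun _ _ _ => rfl }
  have hι : ι ≫ g₁ = ι ≫ g₂ := by
    ext Y x
    exact x.2
  have hlim : IsLimit (Fork.ofι ι hι) := by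
    refine Fork.IsLimit.mk' _ fun s => ⟨
      { app := fun Y => TypeCat.ofHom fun x => (⟨s.ι.app Y x, ?_⟩ : LinearMap.ker (g.app Y).hom)
        naturality := ?_ }, ?_, ?_⟩
    · exact congrArg (fun φ => φ.app Y x) s.condition
    · intro Y Z f
      ext x
      exact Subtype.ext (congrArg (fun φ => φ x) (s.ι.naturality f))
    · rfl
    · intro m hm
      ext Y x
      exact Subtype.ext (congrArg (fun φ => φ.app Y x) hm)
  refine ObjectProperty.prop_of_isLimit _ hlim ?_
  rintro (_ | _)
  · exact hP
  · exact hQ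

/-- The kernel of a morphism of ind-modules. -/
def ker {M N : IndModule F F' A} (g : M ⟶ N) : IndModule F F' A :=
  mkOfScal (kerPresheaf (Hom.hom g).hom)
    (isIndObject_kerPresheaf _ M.obj.property.2.2 N.obj.property.2.2)
    (fun _ _ f h m => Subtype.ext (M.res_add f h m.1))
    (fun _ _ c f m => Subtype.ext (M.res_smul c f m.1))
    (fun c Y => LinearMap.restrict (M.scal c) (p := LinearMap.ker (app g Y))
      (q := LinearMap.ker (app g Y)) fun m hm => by
        rw [LinearMap.mem_ker] at hm ⊢
        rw [app_scal, hm, map_zero])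
    (fun c _ _ f m => Subtype.ext (M.res_scal c f m.1).symm)
    (fun c d _ m => Subtype.ext (M.scal_add c d m.1))
    (fun c d _ m => Subtype.ext (M.scal_smul c d m.1))
    (fun _ m => Subtype.ext (M.scal_one m.1))
    (fun c d _ m => Subtype.ext (M.scal_mul c d m.1))

/-- The inclusion of the kernel of a morphism of ind-modules. -/
def kerι {M N : IndModule F F' A} (g : M ⟶ N) : ker g ⟶ M :=
  homOfApp (fun Y => (LinearMap.ker (app g Y)).subtype) (fun _ _ => rfl) fun _ _ _ => rfl

theorem kerι_injective {M N : IndModule F F' A} (g : M ⟶ N) (Y : A) :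
    Function.Injective (app (kerι g) Y) :=
  Subtype.val_injective

theorem exists_kerι_eq {M N : IndModule F F' A} (g : M ⟶ N) {Y : A} (m : M.Sec Y) :
    (∃ n, app (kerι g) Y n = m) ↔ app g Y m = 0 :=
  ⟨fun ⟨n, hn⟩ => hn ▸ n.2, fun h => ⟨⟨m, h⟩, rfl⟩⟩

/-- The product of two presheaves, computed on sections. -/
def prodPresheaf (P Q : Aᵒᵖ ⥤ ModuleCat.{v} F) : Aᵒᵖ ⥤ ModuleCat.{v} F where
  obj Y := ModuleCat.of F (P.obj Y × Q.obj Y)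
  map f := ModuleCat.ofHom ((P.map f).hom.prodMap (Q.map f).hom)
  map_id Y := by
    refine ModuleCat.hom_ext (LinearMap.ext fun m => Prod.ext ?_ ?_)
    · exact congrArg (fun φ => φ.hom m.1) (P.map_id Y)
    · exact congrArg (fun φ => φ.hom m.2) (Q.map_id Y)
  map_comp f g := by
    refine ModuleCat.hom_ext (LinearMap.ext fun m => Prod.ext ?_ ?_)
    · exact congrArg (fun φ => φ.hom m.1) (P.map_comp f g)
    · exact congrArg (fun φ => φ.hom m.2) (Q.map_comp f g)

omit [Linear F A] in
theorem isIndObject_prodPresheaf {P Q : Aᵒᵖ ⥤ ModuleCat.{v} F}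
    (hP : IsIndObject (P ⋙ forget _)) (hQ : IsIndObject (Q ⋙ forget _)) :
    IsIndObject (prodPresheaf P Q ⋙ forget (ModuleCat.{v} F)) := by
  -- `ULift` places the two-element index type in the universe `v` of the presheaves.
  let R (b : ULift.{v} Bool) : Aᵒᵖ ⥤ Type v :=
    (bif b.down then P else Q) ⋙ forget (ModuleCat.{v} F)
  let π (b : ULift.{v} Bool) : prodPresheaf P Q ⋙ forget (ModuleCat.{v} F) ⟶ R b :=
    match b with
    | ⟨true⟩ =>
      { app := fun Y => TypeCat.ofHom fun x : P.obj Y × Q.obj Y => x.1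
        naturality := fun _ _ _ => rfl }
    | ⟨false⟩ =>
      { app := fun Y => TypeCat.ofHom fun x : P.obj Y × Q.obj Y => x.2
        naturality := fun _ _ _ => rfl }
  have hlim : IsLimit (Fan.mk _ π) := by
    refine Fan.IsLimit.mk _ (fun s =>
      { app := fun Y => TypeCat.ofHom fun x =>
          (((s.proj ⟨true⟩).app Y x, (s.proj ⟨false⟩).app Y x) : P.obj Y × Q.obj Y)
        naturality := ?_ }) ?_ ?_
    · intro Y Z f
      ext x
      exact Prod.ext (congrArg (fun φ => φ x) ((s.proj ⟨true⟩).naturality f))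
        (congrArg (fun φ => φ x) ((s.proj ⟨false⟩).naturality f))
    · rintro s ⟨_ | _⟩ <;> rfl
    · intro s m hm
      ext Y x
      exact Prod.ext (congrArg (fun φ => φ.app Y x) (hm ⟨true⟩))
        (congrArg (fun φ => φ.app Y x) (hm ⟨false⟩))
  have hR : IsIndObject (limit (Discrete.functor R)) := by
    have : HasFiniteProducts A := inferInstance
    have : HasLimitsOfShape (Discrete (ULift.{v} Bool)) A :=
      hasLimitsOfShape_discrete A (ULift.{v} Bool)
    refine isIndObject_limit_of_discrete_of_hasLimitsOfShape _ ?_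
    rintro ⟨⟨_ | _⟩⟩
    · exact hQ
    · exact hP
  exact hR.map (IsLimit.conePointUniqueUpToIso (limit.isLimit _) hlim).hom

/-- The product of two ind-modules. -/
def prod (M N : IndModule F F' A) : IndModule F F' A :=
  mkOfScal (prodPresheaf M.obj.obj N.obj.obj)
    (isIndObject_prodPresheaf M.obj.property.2.2 N.obj.property.2.2)
    (fun _ _ f h m => Prod.ext (M.res_add f h m.1) (N.res_add f h m.2))
    (fun _ _ c f m => Prod.ext (M.res_smul c f m.1) (N.res_smul c f m.2))
    (fun c _ => (M.scal c).prodMap (N.scal c))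
    (fun c _ _ f m => Prod.ext (M.res_scal c f m.1).symm (N.res_scal c f m.2).symm)
    (fun c d _ m => Prod.ext (M.scal_add c d m.1) (N.scal_add c d m.2))
    (fun c d _ m => Prod.ext (M.scal_smul c d m.1) (N.scal_smul c d m.2))
    (fun _ m => Prod.ext (M.scal_one m.1) (N.scal_one m.2))
    (fun c d _ m => Prod.ext (M.scal_mul c d m.1) (N.scal_mul c d m.2))

section

variable {M N K : IndModule F F' A}

/-- The first inclusion into a product of ind-modules. -/
def prodInl : M ⟶ prod M N :=
  homOfApp (fun Y => LinearMap.inl F (M.Sec Y) (N.Sec Y))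
    (fun f _ => Prod.ext rfl (map_zero (N.res f)).symm)
    fun c _ _ => Prod.ext rfl (map_zero (N.scal c)).symm

/-- The second inclusion into a product of ind-modules. -/
def prodInr : N ⟶ prod M N :=
  homOfApp (fun Y => LinearMap.inr F (M.Sec Y) (N.Sec Y))
    (fun f _ => Prod.ext (map_zero (M.res f)).symm rfl)
    fun c _ _ => Prod.ext (map_zero (M.scal c)).symm rfl

/-- The first projection from a product of ind-modules. -/
def prodFst : prod M N ⟶ M :=
  homOfApp (fun Y => LinearMap.fst F (M.Sec Y) (N.Sec Y)) (fun _ _ => rfl) fun _ _ _ => rfl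

/-- The second projection from a product of ind-modules. -/
def prodSnd : prod M N ⟶ N :=
  homOfApp (fun Y => LinearMap.snd F (M.Sec Y) (N.Sec Y)) (fun _ _ => rfl) fun _ _ _ => rfl

theorem prod_hom_ext {f g : prod M N ⟶ K} (h₁ : prodInl ≫ f = prodInl ≫ g)
    (h₂ : prodInr ≫ f = prodInr ≫ g) : f = g := by
  refine ext_app fun Y m => ?_
  have e : m = app (prodInl (M := M) (N := N)) Y m.1 + app (prodInr (M := M) (N := N)) Y m.2 :=
    Prod.ext (add_zero _).symm (zero_add _).symm
  rw [e, map_add, map_add]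
  exact congrArg₂ (· + ·) (congrArg (fun φ => app φ Y m.1) h₁)
    (congrArg (fun φ => app φ Y m.2) h₂)

end

end

end IndModule

section

variable {F F' : Type v} [Field F] [Field F'] [Algebra F F']
  {A : Type u} [Category.{v} A] [Abelian A] [Linear F A]

/-! ### Sections of `F' ⊗ X` -/

theorem pull_smul (X : A) {Y Z : A} (f : Y ⟶ Z) (c : F') (w : F' ⊗[F] (Z ⟶ X)) :
    pull F F' X f (c • w) = c • pull F F' X f w :=
  ((Linear.leftComp F X f).baseChange F').map_smul c w

theorem pull_add_left (X : A) {Y Z : A} (f g : Y ⟶ Z) (w : F' ⊗[F] (Z ⟶ X)) :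
    pull F F' X (f + g) w = pull F F' X f w + pull F F' X g w := by
  have : Linear.leftComp F X (f + g) = Linear.leftComp F X f + Linear.leftComp F X g := by
    ext; simp
  simp [pull, this, LinearMap.lTensor_add]

theorem pull_sum_left (X : A) {Y Z : A} {ι : Type*} (s : Finset ι) (f : ι → (Y ⟶ Z))
    (w : F' ⊗[F] (Z ⟶ X)) :
    pull F F' X (∑ i ∈ s, f i) w = ∑ i ∈ s, pull F F' X (f i) w := by
  classical
  induction s using Finset.induction_on with
  | empty => simpa using pull_zero F F' X w
  | insert a s ha ih => rw [Finset.sum_insert ha, Finset.sum_insert ha, pull_add_left, ih]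

variable (F F') in
/-- Composition of sections of `F' ⊗ X` with a morphism `X ⟶ X'`. -/
abbrev push {X X' : A} (g : X ⟶ X') (Y : A) : F' ⊗[F] (Y ⟶ X) →ₗ[F'] F' ⊗[F] (Y ⟶ X') :=
  (Linear.rightComp F Y g).baseChange F'

theorem push_pull {X X' : A} (g : X ⟶ X') {Y Z : A} (f : Y ⟶ Z) (w : F' ⊗[F] (Z ⟶ X)) :
    push F F' g Y (pull F F' X f w) = pull F F' X' f (push F F' g Z w) := by
  induction w with
  | zero => simp
  | add x y hx hy => simp only [map_add, hx, hy]
  | tmul c h => simp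

/-- The hypothesis `hι` is exactness of the `Hom(Y, -)` sequence at `X`; it survives tensoring
because `F'` is flat over `F`. -/
theorem exists_push_of_push_eq_zero {W X S : A} (ι : W ⟶ X) (p : X ⟶ S)
    (hι : ∀ (Z : A) (g : Z ⟶ X), g ≫ p = 0 ↔ ∃ h : Z ⟶ W, h ≫ ι = g) {Y : A}
    (x : F' ⊗[F] (Y ⟶ X)) (hx : push F F' p Y x = 0) : ∃ w, push F F' ι Y w = x := by
  have hex : Function.Exact (Linear.rightComp F Y ι) (Linear.rightComp F Y p) :=
    fun g => hι Y g
  exact (Module.Flat.lTensor_exact F' hex x).1 hx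

namespace IndModule

variable (M : IndModule F F' A)

theorem res_extFunctor_obj (X : A) {Y Z : A} (f : Y ⟶ Z) (w : F' ⊗[F] (Z ⟶ X)) :
    ((extFunctor F F').obj X).res f w = pull F F' X f w := rfl

theorem scal_extFunctor_obj (X : A) (c : F') {Y : A} (w : F' ⊗[F] (Y ⟶ X)) :
    ((extFunctor F F').obj X).scal c w = c • w := by
  change (LinearMap.mulLeft F c).rTensor (Y ⟶ X) w = c • w
  induction w with
  | zero => simp
  | add x y hx hy => simp only [map_add, hx, hy, smul_add]
  | tmul d h => simp [TensorProduct.smul_tmul']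

/-- The bilinear map underlying `homOfSec`. -/
def secBilin {X : A} (m : M.Sec X) (Y : A) : F' →ₗ[F] (Y ⟶ X) →ₗ[F] M.Sec Y :=
  LinearMap.mk₂ F (fun c f => M.scal c (M.res f m)) (fun c d f => M.scal_add c d _)
    (fun c d f => M.scal_smul c d _) (fun c f g => by rw [res_add, map_add])
    fun c d f => by rw [res_smul, map_smul]

theorem lift_secBilin_pull {X : A} (m : M.Sec X) {Y Z : A} (f : Y ⟶ Z) (w : F' ⊗[F] (Z ⟶ X)) :
    TensorProduct.lift (M.secBilin m Y) (pull F F' X f w) =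
      M.res f (TensorProduct.lift (M.secBilin m Z) w) := by
  induction w with
  | zero => simp only [map_zero]
  | add x y hx hy => simp only [map_add, hx, hy]
  | tmul c g => simp [secBilin, res_scal, res_comp]

theorem lift_secBilin_smul {X : A} (m : M.Sec X) (c : F') {Y : A} (w : F' ⊗[F] (Y ⟶ X)) :
    TensorProduct.lift (M.secBilin m Y) (c • w) =
      M.scal c (TensorProduct.lift (M.secBilin m Y) w) := by
  induction w with
  | zero => simp only [smul_zero, map_zero]
  | add x y hx hy => simp only [smul_add, map_add, hx, hy]
  | tmul d g => simp [secBilin, TensorProduct.smul_tmul', scal_mul]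

/-- The morphism `F' ⊗ X ⟶ M` corresponding to a section of `M` over `X`. -/
def homOfSec {X : A} (m : M.Sec X) : (extFunctor F F').obj X ⟶ M :=
  homOfApp (fun Y => TensorProduct.lift (M.secBilin m Y))
    (fun f w => M.lift_secBilin_pull m f w)
    fun c _ w => (congrArg _ (scal_extFunctor_obj X c w)).trans (M.lift_secBilin_smul m c w)

theorem app_homOfSec_tmul {X : A} (m : M.Sec X) {Y : A} (c : F') (f : Y ⟶ X) :
    app (M.homOfSec m) Y (c ⊗ₜ[F] f) = M.scal c (M.res f m) := rfl

variable (F F') in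
/-- The universal section of `F' ⊗ X` over `X`. -/
def univSec (X : A) : ((extFunctor F F').obj X).Sec X := (1 : F') ⊗ₜ[F] 𝟙 X

theorem app_homOfSec_univSec {X : A} (m : M.Sec X) : app (M.homOfSec m) X (univSec F F' X) = m := by
  rw [univSec, app_homOfSec_tmul, scal_one, res_id]

variable {M} {N : IndModule F F' A}

/-- Every section of `F' ⊗ X` is a sum of scalar multiples of restrictions of `univSec`. Hence
`homOfSec` is a Yoneda bijection from `M.Sec X` to the morphisms `F' ⊗ X ⟶ M`. -/
theorem extFunctor_hom_ext {X : A} {g h : (extFunctor F F').obj X ⟶ M}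
    (H : app g X (univSec F F' X) = app h X (univSec F F' X)) : g = h := by
  refine ext_app fun Y w => ?_
  change F' ⊗[F] (Y ⟶ X) at w
  induction w with
  | zero => exact (map_zero _).trans (map_zero _).symm
  | add x y hx hy => exact (map_add _ x y).trans ((congrArg₂ _ hx hy).trans (map_add _ x y).symm)
  | tmul c f =>
    have : (c ⊗ₜ[F] f : F' ⊗[F] (Y ⟶ X)) = ((extFunctor F F').obj X).scal c
        (((extFunctor F F').obj X).res f (univSec F F' X)) := by
      rw [univSec, res_extFunctor_obj, scal_extFunctor_obj]
      simp [TensorProduct.smul_tmul']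
    erw [this]
    rw [app_scal, app_scal, app_res, app_res, H]

theorem homOfSec_comp {X : A} (m : M.Sec X) (g : M ⟶ N) :
    M.homOfSec m ≫ g = N.homOfSec (app g X m) :=
  extFunctor_hom_ext (by rw [app_comp, app_homOfSec_univSec, app_homOfSec_univSec])

/-- It suffices to test injectivity on sections by morphisms from the objects `F' ⊗ Y`. -/
theorem app_injective (g : N ⟶ M)
    (hg : ∀ (Y : A) (a b : (extFunctor F F').obj Y ⟶ N), a ≫ g = b ≫ g → a = b) (Y : A) :
    Function.Injective (app g Y) := by
  intro m n h
  have := hg Y (N.homOfSec m) (N.homOfSec n) (by rw [homOfSec_comp, homOfSec_comp, h])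
  rw [← N.app_homOfSec_univSec m, this, app_homOfSec_univSec]

theorem app_injective_of_mono (g : N ⟶ M) [Mono g] (Y : A) : Function.Injective (app g Y) :=
  app_injective g (fun _ _ _ h => (cancel_mono g).1 h) Y

end IndModule

/-! ### Saturated subobjects of `F' ⊗ X` -/

variable (F F') in
/-- A family of subspaces of the spaces of sections of `F' ⊗ X` which is stable under restriction
and saturated with respect to epimorphisms. -/
structure ClosedSub (X : A) where
  /-- the subspace of the space of sections over an object -/
  carrier : ∀ Y : A, Submodule F' (F' ⊗[F] (Y ⟶ X))
  pull_mem : ∀ {Y Z : A} (f : Y ⟶ Z) (w : F' ⊗[F] (Z ⟶ X)), w ∈ carrier Z →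
    pull F F' X f w ∈ carrier Y
  mem_of_epi : ∀ {Y Z : A} (p : Y ⟶ Z) [Epi p] (w : F' ⊗[F] (Z ⟶ X)),
    pull F F' X p w ∈ carrier Y → w ∈ carrier Z

namespace ClosedSub

variable {X : A}

theorem carrier_injective : Function.Injective (carrier : ClosedSub F F' X → _) := by
  rintro ⟨_, _, _⟩ ⟨_, _, _⟩ rfl
  rfl

instance : PartialOrder (ClosedSub F F' X) := PartialOrder.lift carrier carrier_injective

/-- The image of a pointwise injective morphism to `F' ⊗ X`. -/
def range {M : IndModule F F' A} (g : M ⟶ (extFunctor F F').obj X)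
    (hg : ∀ Y, Function.Injective (IndModule.app g Y)) : ClosedSub F F' X where
  carrier Y :=
    { carrier := Set.range (IndModule.app g Y)
      zero_mem' := ⟨0, map_zero _⟩
      add_mem' := by
        rintro _ _ ⟨m, rfl⟩ ⟨n, rfl⟩
        exact ⟨m + n, map_add _ _ _⟩
      smul_mem' := by
        rintro c _ ⟨m, rfl⟩
        exact ⟨M.scal c m, (IndModule.app_scal g c m).trans (IndModule.scal_extFunctor_obj X c _)⟩ }
  pull_mem := by
    rintro Y Z f _ ⟨m, rfl⟩
    exact ⟨M.res f m, IndModule.app_res g f m⟩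
  mem_of_epi p _ w h := IndModule.mem_range_of_epi g hg p w h

/-- The preimage of a saturated subobject under a morphism. -/
def comap (N : ClosedSub F F' X) {W : A} (g : W ⟶ X) : ClosedSub F F' W where
  carrier Y := (N.carrier Y).comap (push F F' g Y)
  pull_mem f w hw := by
    rw [Submodule.mem_comap, push_pull]
    exact N.pull_mem f _ hw
  mem_of_epi p _ w hw := by
    rw [Submodule.mem_comap, push_pull] at hw
    exact N.mem_of_epi p _ hw

theorem mem_comap (N : ClosedSub F F' X) {W : A} (g : W ⟶ X) {Y : A} (w : F' ⊗[F] (Y ⟶ W)) :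
    w ∈ (N.comap g).carrier Y ↔ push F F' g Y w ∈ N.carrier Y := Iff.rfl

/-- The saturated image of a saturated subobject under a morphism. -/
def map (N : ClosedSub F F' X) {S : A} (g : X ⟶ S) : ClosedSub F F' S where
  carrier Y :=
    { carrier := {w | ∃ (Z : A) (q : Z ⟶ Y) (_ : Epi q), ∃ n ∈ N.carrier Z,
        push F F' g Z n = pull F F' S q w}
      zero_mem' := ⟨Y, 𝟙 Y, inferInstance, 0, zero_mem _, by simp⟩
      add_mem' := by
        rintro w w' ⟨Z, q, _, n, hn, h⟩ ⟨Z', q', _, n', hn', h'⟩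
        -- Two local lifts are added on the common refinement of their covers.
        refine ⟨pullback q q', pullback.fst q q' ≫ q, epi_comp _ _,
          pull F F' X (pullback.fst q q') n + pull F F' X (pullback.snd q q') n',
          add_mem (N.pull_mem _ _ hn) (N.pull_mem _ _ hn'), ?_⟩
        rw [map_add, push_pull, push_pull, h, h', map_add, ← pull_comp, ← pull_comp,
          pullback.condition]
      smul_mem' := by
        rintro c w ⟨Z, q, _, n, hn, h⟩
        exact ⟨Z, q, inferInstance, c • n, Submodule.smul_mem _ c hn, by
          rw [map_smul, h, pull_smul]⟩ }
  pull_mem := by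
    rintro Y Y' f w ⟨Z, q, _, n, hn, h⟩
    refine ⟨pullback f q, pullback.fst f q, inferInstance, pull F F' X (pullback.snd f q) n,
      N.pull_mem _ _ hn, ?_⟩
    rw [push_pull, h, ← pull_comp, ← pull_comp, pullback.condition]
  mem_of_epi := by
    rintro Y Y' p _ w ⟨Z, q, _, n, hn, h⟩
    exact ⟨Z, q ≫ p, epi_comp _ _, n, hn, by rw [h, pull_comp]⟩

theorem comap_mono {N N' : ClosedSub F F' X} (h : N ≤ N') {W : A} (g : W ⟶ X) :
    N.comap g ≤ N'.comap g := fun _ _ hw => h _ hw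

theorem map_mono {N N' : ClosedSub F F' X} (h : N ≤ N') {S : A} (g : X ⟶ S) :
    N.map g ≤ N'.map g := by
  rintro Y w ⟨Z, q, hq, n, hn, e⟩
  exact ⟨Z, q, hq, n, h _ hn, e⟩

/-- For `y` in `N'`, the image in `S` lifts to some `n` in `N` after passing to a cover. The
difference of `y` and `n` comes from `W`, where `N'` lies in `N`; saturation then descends
membership from the cover. -/
theorem le_of_comap_le_of_map_le {W S : A} (ι : W ⟶ X) (p : X ⟶ S)
    (hι : ∀ (Z : A) (g : Z ⟶ X), g ≫ p = 0 ↔ ∃ h : Z ⟶ W, h ≫ ι = g)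
    {N N' : ClosedSub F F' X} (h : N ≤ N') (h₁ : N'.comap ι ≤ N.comap ι)
    (h₂ : N'.map p ≤ N.map p) : N' ≤ N := by
  intro Y y hy
  obtain ⟨Z, q, _, n, hn, e⟩ := h₂ Y (show push F F' p Y y ∈ _ from
    ⟨Y, 𝟙 Y, inferInstance, y, hy, by rw [pull_id]⟩)
  rw [← push_pull] at e
  obtain ⟨w, hw⟩ := exists_push_of_push_eq_zero ι p hι (pull F F' X q y - n) (by
    rw [map_sub, e, sub_self])
  have hw' : w ∈ (N'.comap ι).carrier Z := by
    rw [mem_comap, hw]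
    exact sub_mem (N'.pull_mem _ _ hy) (h _ hn)
  have := h₁ _ hw'
  rw [mem_comap, hw] at this
  refine N.mem_of_epi q y ?_
  simpa using add_mem this hn

end ClosedSub

/-! ### Sections of `F' ⊗ S` for a simple object `S` -/

/-- Linear algebra over the division ring `End S`: a morphism to `S` vanishing on the common kernel
of the `f i` is a combination of them. -/
theorem exists_eq_sum_comp {Y S : A} [Simple S] {ι : Type*} (f : ι → (Y ⟶ S)) (s : Finset ι)
    (g : Y ⟶ S) (hg : ∀ (K : A) (h : K ⟶ Y), (∀ i ∈ s, h ≫ f i = 0) → h ≫ g = 0) :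
    ∃ d : ι → (S ⟶ S), g = ∑ i ∈ s, f i ≫ d i := by
  classical
  induction s using Finset.induction_on generalizing g with
  | empty => exact ⟨0, by simpa using hg Y (𝟙 Y) (by simp)⟩
  | insert a s ha ih =>
    let K : Subobject Y := s.inf fun i => kernelSubobject (f i)
    have hK {Z : A} (h : Z ⟶ Y) : (∀ i ∈ s, h ≫ f i = 0) ↔ K.Factors h := by
      rw [Subobject.finset_inf_factors]
      simp only [kernelSubobject_factors_iff]
    have hKa : ∀ i ∈ s, K.arrow ≫ f i = 0 := (hK _).2 (Subobject.factors_self K)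
    by_cases h0 : K.arrow ≫ f a = 0
    · obtain ⟨d, hd⟩ := ih g fun Z h hh => hg Z h fun i hi => by
        rcases Finset.mem_insert.1 hi with rfl | hi
        · rw [← Subobject.factorThru_arrow K h ((hK h).1 hh), Category.assoc, h0, comp_zero]
        · exact hh i hi
      refine ⟨fun i => if i = a then 0 else d i, ?_⟩
      simp only [Finset.sum_insert ha, if_true]
      rw [comp_zero, zero_add, hd]
      exact Finset.sum_congr rfl fun i hi => by rw [if_neg (ne_of_mem_of_not_mem hi ha)]
    -- On the common kernel `K` of the others, `f a` is onto `S` and `g` factors through it by some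
    -- `e`; so `g - f a ≫ e` vanishes on `K` and induction applies.
    · have : Epi (K.arrow ≫ f a) := epi_of_nonzero_to_simple h0
      have hz : kernel.ι (K.arrow ≫ f a) ≫ K.arrow ≫ g = 0 := by
        rw [← Category.assoc]
        refine hg _ _ fun i hi => ?_
        rcases Finset.mem_insert.1 hi with rfl | hi
        · rw [Category.assoc, kernel.condition]
        · rw [Category.assoc, hKa i hi, comp_zero]
      let e := Abelian.epiDesc (K.arrow ≫ f a) (K.arrow ≫ g) hz
      have he : (K.arrow ≫ f a) ≫ e = K.arrow ≫ g := Abelian.comp_epiDesc _ _ hz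
      obtain ⟨d, hd⟩ := ih (g - f a ≫ e) fun Z h hh => by
        rw [← Subobject.factorThru_arrow K h ((hK h).1 hh), Category.assoc, Preadditive.comp_sub,
          ← he, Category.assoc, sub_self, comp_zero]
      refine ⟨fun i => if i = a then e else d i, ?_⟩
      simp only [Finset.sum_insert ha, if_true]
      rw [← sub_eq_iff_eq_add', hd]
      exact Finset.sum_congr rfl fun i hi => by rw [if_neg (ne_of_mem_of_not_mem hi ha)]

/-- Redundant `f i` are eliminated first. For independent `f i`, each one is nonzero, hence epi, on
the common kernel of the others; restricting the sum there isolates `r i`, and saturation puts it in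
`N.carrier S`. -/
theorem ClosedSub.mem_of_eq_sum {S : A} [Simple S] {N N' : ClosedSub F F' S}
    (h : N.carrier S ≤ N'.carrier S) {Y : A} {ι : Type*} (s : Finset ι) (f : ι → (Y ⟶ S))
    (r : ι → F' ⊗[F] (S ⟶ S)) (hN : ∑ i ∈ s, pull F F' S (f i) (r i) ∈ N.carrier Y) :
    ∑ i ∈ s, pull F F' S (f i) (r i) ∈ N'.carrier Y := by
  classical
  induction s using Finset.strongInduction generalizing r with
  | H s ih =>
    by_cases hs : ∃ i ∈ s, ∃ d : ι → (S ⟶ S), f i = ∑ j ∈ s.erase i, f j ≫ d j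
    · obtain ⟨i, hi, d, hd⟩ := hs
      have e : ∑ j ∈ s, pull F F' S (f j) (r j) =
          ∑ j ∈ s.erase i, pull F F' S (f j) (r j + pull F F' S (d j) (r i)) := by
        rw [← Finset.add_sum_erase s _ hi, hd, pull_sum_left, ← Finset.sum_add_distrib]
        refine Finset.sum_congr rfl fun j _ => ?_
        rw [pull_comp, map_add, add_comm]
      rw [e] at hN ⊢
      exact ih _ (Finset.erase_ssubset hi) _ hN
    · push Not at hs
      refine Submodule.sum_mem _ fun i hi => N'.pull_mem _ _ (h ?_)
      obtain ⟨K, k, hk, hki⟩ : ∃ (K : A) (k : K ⟶ Y), (∀ j ∈ s.erase i, k ≫ f j = 0) ∧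
          k ≫ f i ≠ 0 := by
        by_contra! hc
        obtain ⟨d, hd⟩ := exists_eq_sum_comp f (s.erase i) (f i) hc
        exact hs i hi d hd
      have : Epi (k ≫ f i) := epi_of_nonzero_to_simple hki
      refine N.mem_of_epi (k ≫ f i) _ ?_
      have := N.pull_mem k _ hN
      rw [map_sum, ← Finset.add_sum_erase s _ hi, Finset.sum_eq_zero (s := s.erase i), add_zero,
        ← pull_comp] at this
      · exact this
      · intro j hj
        rw [← pull_comp, hk j hj, pull_zero]

/-- A tensor `∑ c ⊗ g` is the sum of the restrictions along `g` of the sections `c ⊗ 𝟙 S`, which is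
the shape handled by `mem_of_eq_sum`. -/
theorem ClosedSub.le_of_carrier_le {S : A} [Simple S] {N N' : ClosedSub F F' S}
    (h : N.carrier S ≤ N'.carrier S) : N ≤ N' := by
  intro Y x hx
  obtain ⟨s, hs⟩ := TensorProduct.exists_finset x
  have e : x = ∑ i ∈ s, pull F F' S i.2 (i.1 ⊗ₜ[F] 𝟙 S) := by
    rw [hs]
    simp
  rw [e] at hx ⊢
  exact mem_of_eq_sum h s _ _ hx

/-! ### Finite length of `F' ⊗ X` -/

variable (F F') in
/-- There is a bounded strictly monotone rank function on the saturated subobjects of `F' ⊗ X`. -/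
def HasRank (X : A) : Prop :=
  ∃ (n : ℕ) (d : ClosedSub F F' X → ℕ), StrictMono d ∧ ∀ N, d N ≤ n

/-- The rank is the dimension over `F'` of the sections over `S`, inside the finite-dimensional `F'
⊗ End S`; it is strictly monotone since these sections determine the subobject. -/
theorem hasRank_of_simple (S : A) [Simple S] [FiniteDimensional F (End S)] : HasRank F F' S := by
  have : FiniteDimensional F (S ⟶ S) := ‹FiniteDimensional F (End S)›
  refine ⟨_, fun N => Module.finrank F' (N.carrier S), fun N N' h => ?_,
    fun N => Submodule.finrank_le _⟩
  refine Submodule.finrank_lt_finrank_of_lt (lt_of_le_not_ge (h.1 S) fun hle => h.2 ?_)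
  exact ClosedSub.le_of_carrier_le hle

theorem hasRank_of_isZero {X : A} (hX : IsZero X) : HasRank F F' X := by
  refine ⟨0, fun _ => 0, fun N N' h => (h.2 fun Y x _ => ?_).elim, fun _ => le_rfl⟩
  have : Subsingleton (Y ⟶ X) := ⟨fun f g => hX.eq_of_tgt f g⟩
  rw [Subsingleton.elim x 0]
  exact zero_mem _

/-- The rank is the sum of the ranks of the trace on `W` and of the image in `S`; a strict inclusion
must be strict in one of the two. -/
theorem HasRank.of_exact {W X S : A} (ι : W ⟶ X) (p : X ⟶ S)
    (hι : ∀ (Z : A) (g : Z ⟶ X), g ≫ p = 0 ↔ ∃ h : Z ⟶ W, h ≫ ι = g)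
    (hW : HasRank F F' W) (hS : HasRank F F' S) : HasRank F F' X := by
  obtain ⟨n, d, hd, hn⟩ := hW
  obtain ⟨n', d', hd', hn'⟩ := hS
  refine ⟨n + n', fun N => d (N.comap ι) + d' (N.map p), fun N N' h => ?_,
    fun N => add_le_add (hn _) (hn' _)⟩
  have h₁ := ClosedSub.comap_mono h.1 ι
  have h₂ := ClosedSub.map_mono h.1 p
  rcases h₁.lt_or_eq with h₁' | h₁'
  · exact add_lt_add_of_lt_of_le (hd h₁') (hd'.monotone h₂)
  · rcases h₂.lt_or_eq with h₂' | h₂'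
    · exact add_lt_add_of_le_of_lt (hd.monotone h₁) (hd' h₂')
    · exact (h.2 (ClosedSub.le_of_comap_le_of_map_le ι p hι h.1 h₁'.ge h₂'.ge)).elim

-- If the two were equal, the projection of the preimage onto `S` would be both epi and zero.
omit [Linear F A] in
theorem lt_pullback_cokernel_π {X : A} (W : Subobject X) (S : Subobject (cokernel W.arrow))
    [Simple (S : A)] : W < (Subobject.pullback (cokernel.π W.arrow)).obj S := by
  have hpb := Subobject.isPullback (cokernel.π W.arrow) S
  refine lt_of_le_of_ne (Subobject.le_of_comm (hpb.lift 0 W.arrow (by simp)) (hpb.lift_snd _ _ _))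
    fun heq => ?_
  let π := Subobject.pullbackπ (cokernel.π W.arrow) S
  have : Epi π := Abelian.epi_fst_of_isLimit _ _ hpb.isLimit
  have h0 : π ≫ S.arrow = 0 := by
    rw [hpb.w, ← Subobject.ofLE_arrow heq.ge, Category.assoc, cokernel.condition, comp_zero]
  rw [← zero_comp (f := S.arrow), cancel_mono] at h0
  have h1 : 𝟙 (S : A) = 0 := by rw [← cancel_epi π, Category.comp_id, comp_zero, h0]
  exact id_nonzero _ h1

/-- Take `W` maximal among the subobjects with a rank. If `W` were proper, the preimage of a simple
subobject of `X / W` would be a larger one. -/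
theorem hasRank_of_isFieldFinite (hA : IsFieldFinite F A) (X : A) : HasRank F F' X := by
  have := (hA X).1.1
  obtain ⟨W, hW, hmax⟩ := WellFounded.has_min (wellFounded_gt (α := Subobject X))
    {W : Subobject X | HasRank F F' (W : A)} ⟨⊥, hasRank_of_isZero (by
      exact (isZero_zero A).of_iso Subobject.botCoeIsoZero)⟩
  by_cases hQ : IsZero (cokernel W.arrow)
  · have : Epi W.arrow := Preadditive.epi_of_isZero_cokernel _ hQ
    have : IsIso W.arrow := isIso_of_mono_of_epi _
    refine HasRank.of_exact W.arrow (0 : X ⟶ (⊥ : Subobject X)) (fun Z g => ⟨fun _ => ?_, fun _ => comp_zero⟩) hW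
      (hasRank_of_isZero ((isZero_zero A).of_iso Subobject.botCoeIsoZero))
    exact ⟨g ≫ inv W.arrow, by simp⟩
  · have := (hA (cokernel W.arrow)).1.2
    obtain ⟨S, hS⟩ := exists_simple_subobject hQ
    have := (hA (S : A)).2
    have hlt := lt_pullback_cokernel_π W S
    have hpb := Subobject.isPullback (cokernel.π W.arrow) S
    refine (hmax _ (HasRank.of_exact (Subobject.ofLE _ _ hlt.le)
      (Subobject.pullbackπ (cokernel.π W.arrow) S) (fun Z g => ⟨fun hg => ?_, ?_⟩) hW
      (hasRank_of_simple _)) hlt).elim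
    · have h0 : (g ≫ ((Subobject.pullback (cokernel.π W.arrow)).obj S).arrow) ≫
          cokernel.π W.arrow = 0 := by
        rw [Category.assoc, ← hpb.w, ← Category.assoc, hg, zero_comp]
      refine ⟨Abelian.monoLift W.arrow _ h0, ?_⟩
      rw [← cancel_mono ((Subobject.pullback (cokernel.π W.arrow)).obj S).arrow, Category.assoc,
        Subobject.ofLE_arrow, Abelian.monoLift_comp]
    · rintro ⟨h, rfl⟩
      rw [← cancel_mono S.arrow, Category.assoc, Category.assoc, hpb.w, Subobject.ofLE_arrow_assoc,
        cokernel.condition, comp_zero, zero_comp]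

/-- Taking sections embeds the poset of subobjects into `ClosedSub`, so a bounded strictly monotone
rank yields both chain conditions. -/
theorem hasFiniteLength_of_hasRank {X : A} (h : HasRank F F' X) :
    HasFiniteLength ((extFunctor F F').obj X) := by
  obtain ⟨n, d, hd, hn⟩ := h
  let r (N : Subobject ((extFunctor F F').obj X)) : ClosedSub F F' X :=
    ClosedSub.range N.arrow (IndModule.app_injective_of_mono N.arrow)
  have hr {N N' : Subobject ((extFunctor F F').obj X)} : N ≤ N' ↔ r N ≤ r N' := by
    constructor
    · rintro hle Y _ ⟨m, rfl⟩
      exact ⟨IndModule.app (Subobject.ofLE N N' hle) Y m, by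
        rw [← IndModule.app_comp, Subobject.ofLE_arrow]⟩
    · intro hle
      obtain ⟨φ, hφ⟩ := IndModule.exists_factor N.arrow N'.arrow
        (IndModule.app_injective_of_mono N'.arrow) fun Y m => hle Y ⟨m, rfl⟩
      exact Subobject.le_of_comm φ hφ
  have hs : StrictMono fun N => d (r N) := fun N N' h =>
    hd ⟨hr.1 h.1, fun h' => h.2 (hr.2 h')⟩
  refine ⟨⟨?_⟩, ⟨?_⟩⟩
  -- Ascending chains strictly decrease the corank `n - d (r N)`; the bound `hn` keeps the truncated
  -- subtraction honest.
  · let e : Subobject ((extFunctor F F').obj X) → ℕ := fun N => n - d (r N)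
    have he : ∀ N N', N > N' → e N < e N' := fun N N' h => by
      have h1 : d (r N') < d (r N) := hs h
      have h2 := hn (r N)
      simp only [e]
      omega
    exact ⟨Subrelation.wf (fun {a b} h => he a b h) (InvImage.wf e Nat.lt_wfRel.wf)⟩
  · exact hs.wellFoundedLT

end

section

variable {F F' : Type v} [Field F] [Field F'] [Algebra F F']
  {A : Type u} [Category.{v} A] [Abelian A] [Linear F A]

/-! ### Morphisms of the scalar extension -/

namespace ScalarExtension

/-- The test objects `F' ⊗ Z` have finite length by `ht`, so being mono in the full subcategory
already suffices. -/
theorem app_injective_of_mono (ht : ∀ X : A, HasFiniteLength ((extFunctor F F').obj X))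
    {M N : ScalarExtension F F' A} (g : M ⟶ N) [Mono g] (Y : A) :
    Function.Injective (IndModule.app g.hom Y) := by
  refine IndModule.app_injective g.hom (fun Z a b h => ?_) Y
  let T : ScalarExtension F F' A := (toScalarExtension F F' ht).obj Z
  let a' : T ⟶ M := ObjectProperty.homMk a
  let b' : T ⟶ M := ObjectProperty.homMk b
  have : a' = b' := (cancel_mono g).1 (ObjectProperty.hom_ext _ h)
  exact congrArg (fun φ => φ.hom) this

theorem mono_of_injective {M N : ScalarExtension F F' A} (g : M ⟶ N)
    (hg : ∀ Y, Function.Injective (IndModule.app g.hom Y)) : Mono g := by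
  have := IndModule.mono_of_injective g.hom hg
  refine ⟨fun a b h => ObjectProperty.hom_ext _ ?_⟩
  exact (cancel_mono g.hom).1 (congrArg (fun φ => φ.hom) h)

theorem isIso_of_bijective {M N : ScalarExtension F F' A} (g : M ⟶ N)
    (hg : ∀ Y, Function.Bijective (IndModule.app g.hom Y)) : IsIso g := by
  have := IndModule.isIso_of_bijective g.hom hg
  exact ⟨ObjectProperty.homMk (inv g.hom), ObjectProperty.hom_ext _ (IsIso.hom_inv_id g.hom),
    ObjectProperty.hom_ext _ (IsIso.inv_hom_id g.hom)⟩

end ScalarExtension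

theorem HasFiniteLength.of_mono {C : Type*} [Category* C] {X Y : C} (f : X ⟶ Y) [Mono f]
    (h : HasFiniteLength Y) : HasFiniteLength X :=
  have := h.1
  have := h.2
  ⟨isNoetherianObject_of_mono f, isArtinianObject_of_mono f⟩

/-! ### Right ideals and saturated subobjects -/

/-- The product in `End S` is composition in reverse order, so right multiplication by `g` is
restriction along `g`. This turns saturated subobjects of `F' ⊗ S` into right ideals. -/
theorem tensor_mul_tmul {S : A} (x : F' ⊗[F] End S) (c : F') (g : End S) :
    x * (c ⊗ₜ[F] g) = c • pull F F' S (g : S ⟶ S) x := by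
  induction x with
  | zero => rw [zero_mul]; exact ((congrArg _ (map_zero _)).trans (smul_zero c)).symm
  | add x y hx hy =>
    rw [add_mul, hx, hy]
    exact ((congrArg _ (map_add _ x y)).trans (smul_add c _ _)).symm
  | tmul d f =>
    rw [Algebra.TensorProduct.tmul_mul_tmul, mul_comm]
    rfl

theorem app_homOfSec_eq_mul {S : A} (e x : F' ⊗[F] End S) :
    IndModule.app (((extFunctor F F').obj S).homOfSec e) S x = e * x := by
  induction x with
  | zero => rw [mul_zero]; exact map_zero _
  | add x y hx hy => rw [mul_add, ← hx, ← hy]; exact map_add _ x y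
  | tmul c f =>
    rw [tensor_mul_tmul]
    exact (IndModule.app_homOfSec_tmul _ _ _ _).trans (IndModule.scal_extFunctor_obj _ _ _)

theorem push_injective {X X' : A} (g : X ⟶ X') [Mono g] (Y : A) :
    Function.Injective (push F F' g Y) :=
  Module.Flat.lTensor_preserves_injective_linearMap (M := F') (Linear.rightComp F Y g)
    fun _ _ h => (cancel_mono g).1 h

namespace ClosedSub

/-- The right ideal of `F' ⊗ End S` given by a saturated subobject of `F' ⊗ S`. -/
def rightIdeal {S : A} (N : ClosedSub F F' S) :
    Submodule (F' ⊗[F] End S)ᵐᵒᵖ (F' ⊗[F] End S) where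
  carrier := {x | x ∈ N.carrier S}
  zero_mem' := (N.carrier S).zero_mem
  add_mem' := (N.carrier S).add_mem
  smul_mem' := by
    rintro ⟨r⟩ x hx
    change x * r ∈ N.carrier S
    induction r with
    | zero => rw [mul_zero]; exact (N.carrier S).zero_mem
    | add r s hr hs => rw [mul_add]; exact (N.carrier S).add_mem hr hs
    | tmul c g => rw [tensor_mul_tmul]; exact (N.carrier S).smul_mem c (N.pull_mem g x hx)

theorem mem_rightIdeal {S : A} (N : ClosedSub F F' S) (x : F' ⊗[F] End S) :
    x ∈ N.rightIdeal ↔ x ∈ N.carrier S := Iff.rfl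

theorem le_of_rightIdeal_le {S : A} [Simple S] {N N' : ClosedSub F F' S}
    (h : N.rightIdeal ≤ N'.rightIdeal) : N ≤ N' :=
  le_of_carrier_le fun x hx => h (show x ∈ N.rightIdeal from hx)

instance (X : A) : Bot (ClosedSub F F' X) where
  bot :=
    { carrier := fun _ => ⊥
      pull_mem := by
        rintro Y Z f _ rfl
        exact map_zero _
      mem_of_epi := fun p _ w hw =>
        (IndModule.res_injective ((extFunctor F F').obj X) p)
          (Eq.trans (b := (0 : F' ⊗[F] (_ ⟶ X))) ((Submodule.mem_bot F').1 hw) (map_zero _).symm) }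

theorem mem_bot {X Y : A} (w : F' ⊗[F] (Y ⟶ X)) :
    w ∈ (⊥ : ClosedSub F F' X).carrier Y ↔ w = 0 := Iff.rfl

end ClosedSub

/-- Write `1 = e + e'` along a complement `L'`. For `x` in `L`, the element `x - e * x = e' * x`
lies in both `L` and `L'`. -/
theorem exists_idempotent_of_rightIdeal {R : Type*} [Ring R] [IsSemisimpleRing R]
    (L : Submodule Rᵐᵒᵖ R) : ∃ e ∈ L, ∀ x, x ∈ L ↔ e * x = x := by
  obtain ⟨L', hL⟩ := exists_isCompl L
  obtain ⟨e, he, e', he', h1⟩ := Submodule.mem_sup.1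
    (hL.sup_eq_top.symm ▸ Submodule.mem_top : (1 : R) ∈ L ⊔ L')
  have hmul (I : Submodule Rᵐᵒᵖ R) {y : R} (hy : y ∈ I) (x : R) : y * x ∈ I :=
    I.smul_mem (MulOpposite.op x) hy
  refine ⟨e, he, fun x => ⟨fun hx => ?_, fun hx => hx ▸ hmul L he x⟩⟩
  have h : x - e * x = e' * x := by
    rw [sub_eq_iff_eq_add, ← add_mul, add_comm, h1, one_mul]
  have h2 : x - e * x ∈ L ⊓ L' := ⟨sub_mem hx (hmul L he x), h ▸ hmul L' he' x⟩
  rw [hL.inf_eq_bot, Submodule.mem_bot, sub_eq_zero] at h2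
  exact h2.symm

/-- A minimal right ideal of `F' ⊗ End S` is cut out by a simple subobject of `F' ⊗ S`. -/
theorem exists_simple_of_rightIdeal
    (ht : ∀ X : A, HasFiniteLength ((extFunctor F F').obj X)) {S : A} [Simple S]
    [IsSemisimpleRing (F' ⊗[F] End S)] (L : Submodule (F' ⊗[F] End S)ᵐᵒᵖ (F' ⊗[F] End S))
    [IsSimpleModule (F' ⊗[F] End S)ᵐᵒᵖ L] :
    ∃ (E : ScalarExtension F F' A) (j : E ⟶ (toScalarExtension F F' ht).obj S),
      Simple E ∧ (∀ Y, Function.Injective (IndModule.app j.hom Y)) ∧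
      ∀ x : F' ⊗[F] End S, x ∈ L ↔ ∃ y, IndModule.app j.hom S y = x := by
  obtain ⟨e, he, heL⟩ := exists_idempotent_of_rightIdeal L
  -- Over `S` this is `x ↦ x - e * x`, so the sections of its kernel over `S` are exactly `L`.
  let φ : (extFunctor F F').obj S ⟶ (extFunctor F F').obj S :=
    𝟙 _ - ((extFunctor F F').obj S).homOfSec e
  have := IndModule.mono_of_injective (IndModule.kerι φ) (IndModule.kerι_injective φ)
  let E : ScalarExtension F F' A := ⟨IndModule.ker φ, (ht S).of_mono (IndModule.kerι φ)⟩
  let j : E ⟶ (toScalarExtension F F' ht).obj S := ObjectProperty.homMk (IndModule.kerι φ)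
  have hj : ∀ Y, Function.Injective (IndModule.app j.hom Y) := IndModule.kerι_injective φ
  have hjL (x : F' ⊗[F] End S) : x ∈ L ↔ ∃ y, IndModule.app j.hom S y = x := by
    rw [heL]
    refine Iff.trans ?_ (IndModule.exists_kerι_eq φ x).symm
    have hφ : IndModule.app φ S x = x - e * x :=
      (IndModule.app_sub (𝟙 _) (((extFunctor F F').obj S).homOfSec e) S x).trans
        (congrArg (fun z : F' ⊗[F] End S => x - z) (app_homOfSec_eq_mul e x))
    exact eq_comm.trans (sub_eq_zero.symm.trans (hφ ▸ Iff.rfl))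
  refine ⟨E, j, ⟨fun {G} g _ => ⟨?_, fun hg0 => ?_⟩⟩, hj, hjL⟩
  · rintro _ rfl
    obtain ⟨x, hx, hx0⟩ := L.ne_bot_iff.1 (isSimpleModule_iff_isAtom.1 inferInstance).1
    obtain ⟨y, rfl⟩ := (hjL x).1 hx
    have h0 : 𝟙 E = 0 := by rw [← IsIso.inv_hom_id (0 : G ⟶ E), comp_zero]
    have : y = 0 := congrArg (fun ψ : E ⟶ E => IndModule.app ψ.hom S y) h0
    exact hx0 (by rw [this]; exact map_zero _)
  · have hg := ScalarExtension.app_injective_of_mono ht g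
    have hgj : ∀ Y, Function.Injective (IndModule.app (g ≫ j).hom Y) := fun Y => (hj Y).comp (hg Y)
    -- The right ideal of a subobject of `E` lies in the atom `L`, so it is zero or `L`; since it
    -- determines the subobject, `g` is zero or an isomorphism.
    let N := ClosedSub.range (g ≫ j).hom hgj
    let N' := ClosedSub.range j.hom hj
    have hNL : N.rightIdeal ≤ L := by
      rintro _ ⟨y, rfl⟩
      exact (hjL _).2 ⟨IndModule.app g.hom S y, rfl⟩
    have hL : N'.rightIdeal = L := by
      ext x
      exact (hjL x).symm
    have hatom : IsAtom L := isSimpleModule_iff_isAtom.1 inferInstance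
    rcases hatom.le_iff.1 hNL with h | h
    · refine (hg0 (ObjectProperty.hom_ext _ (IndModule.ext_app fun Y m => ?_))).elim
      have hle : N ≤ ⊥ := ClosedSub.le_of_rightIdeal_le (h.trans_le bot_le)
      have := (ClosedSub.mem_bot _).1 (hle Y ⟨m, rfl⟩)
      exact hj Y (this.trans (map_zero _).symm)
    · refine ScalarExtension.isIso_of_bijective g fun Y => ⟨hg Y, fun m => ?_⟩
      have hle : N' ≤ N := ClosedSub.le_of_rightIdeal_le (hL.trans h.symm).le
      obtain ⟨n, hn⟩ := hle Y ⟨m, rfl⟩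
      exact ⟨n, hj Y hn⟩

/-! ### Semisimplicity of `F' ⊗ X` -/

/-- The preimage of `Y` in `F' ⊗ S` contains every minimal right ideal, because each comes from a
simple object embedded in `F' ⊗ X`. As `F' ⊗ End S` is semisimple, the preimage contains `1`. -/
theorem tmul_arrow_mem_of_simple (hF' : IsSeparableExtension F F')
    (hA : IsFieldFinite F A) (ht : ∀ X : A, HasFiniteLength ((extFunctor F F').obj X))
    {X : A} (Y : Subobject ((toScalarExtension F F' ht).obj X))
    (hY : ∀ T : Subobject ((toScalarExtension F F' ht).obj X),
      Simple (T : ScalarExtension F F' A) → T ≤ Y) {S : A} [Simple S] (ι : S ⟶ X) [Mono ι] :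
    (1 : F') ⊗ₜ[F] ι ∈ (ClosedSub.range Y.arrow.hom
      (ScalarExtension.app_injective_of_mono ht Y.arrow)).carrier S := by
  let N := ClosedSub.range Y.arrow.hom (ScalarExtension.app_injective_of_mono ht Y.arrow)
  have := (hA S).2
  have : IsSemisimpleRing (F' ⊗[F] End S) := isSemisimpleRing_tensorProduct hF' (End S)
  have htop : (N.comap ι).rightIdeal = ⊤ := by
    rw [eq_top_iff, ← IsSemisimpleModule.sSup_simples_eq_top, sSup_le_iff]
    intro L (hL : IsSimpleModule _ L)
    obtain ⟨E, j, hE, hj, hjL⟩ := exists_simple_of_rightIdeal ht L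
    let k := j ≫ (toScalarExtension F F' ht).map ι
    have hk : ∀ Y, Function.Injective (IndModule.app k.hom Y) := fun Y =>
      (push_injective ι Y).comp (hj Y)
    have := ScalarExtension.mono_of_injective k hk
    have hle := hY (Subobject.mk k) (Simple.of_iso (Subobject.underlyingIso k))
    intro x hx
    obtain ⟨y, rfl⟩ := (hjL x).1 hx
    refine ⟨IndModule.app (Subobject.ofMkLE k Y hle).hom S y, ?_⟩
    have := congrArg (fun ψ => IndModule.app ψ.hom S y) (Subobject.ofMkLE_arrow hle)
    exact this
  have h1 : (1 : F' ⊗[F] End S) ∈ (N.comap ι).rightIdeal := htop ▸ Submodule.mem_top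
  rw [ClosedSub.mem_rightIdeal, ClosedSub.mem_comap] at h1
  have h2 : push F F' ι S ((1 : F') ⊗ₜ[F] 𝟙 S) = (1 : F') ⊗ₜ[F] ι := by simp
  rw [← h2]
  exact h1

/-- A maximal `W` with `F' ⊗ W` inside `Y` absorbs every simple subobject of `X`, by passing to the
image of `S ⊞ W`; so `W = ⊤`. -/
theorem isSemisimpleObject_toScalarExtension (hF' : IsSeparableExtension F F')
    (hA : IsFieldFinite F A) (ht : ∀ X : A, HasFiniteLength ((extFunctor F F').obj X))
    {X : A} (hX : IsSemisimpleObject X) :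
    IsSemisimpleObject ((toScalarExtension F F' ht).obj X) := by
  intro Y hY
  have hinj := ScalarExtension.app_injective_of_mono ht Y.arrow
  let N := ClosedSub.range Y.arrow.hom hinj
  have := (hA X).1.1
  obtain ⟨W, hW, hmax⟩ := WellFounded.has_min (wellFounded_gt (α := Subobject X))
    {W : Subobject X | (1 : F') ⊗ₜ[F] W.arrow ∈ N.carrier W} ⟨⊥, by
      rw [Set.mem_ofPred_eq, Subobject.bot_arrow, TensorProduct.tmul_zero]
      exact zero_mem _⟩
  have htop : W = ⊤ := by
    refine hX W fun S hS => ?_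
    let f : (S : A) ⊞ (W : A) ⟶ X := biprod.desc S.arrow W.arrow
    let e := factorThruImageSubobject f
    have he : e ≫ (imageSubobject f).arrow = f := imageSubobject_arrow_comp f
    have hSI : S ≤ imageSubobject f := Subobject.le_of_comm (biprod.inl ≫ e) (by
      rw [Category.assoc, he, biprod.inl_desc])
    have hWI : W ≤ imageSubobject f := Subobject.le_of_comm (biprod.inr ≫ e) (by
      rw [Category.assoc, he, biprod.inr_desc])
    have hI : (1 : F') ⊗ₜ[F] (imageSubobject f).arrow ∈ N.carrier (imageSubobject f : A) := by
      refine N.mem_of_epi e _ ?_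
      have hsum : pull F F' X e ((1 : F') ⊗ₜ[F] (imageSubobject f).arrow) =
          pull F F' X biprod.fst ((1 : F') ⊗ₜ[F] S.arrow) +
            pull F F' X biprod.snd ((1 : F') ⊗ₜ[F] W.arrow) := by
        simp only [LinearMap.lTensor_tmul, Linear.leftComp_apply, he, ← TensorProduct.tmul_add]
        rw [← biprod.desc_eq]
      rw [hsum]
      exact add_mem (N.pull_mem _ _ (tmul_arrow_mem_of_simple hF' hA ht Y hY S.arrow))
        (N.pull_mem _ _ hW)
    rcases hWI.lt_or_eq with h | h
    · exact (hmax _ hI h).elim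
    · rwa [h]
  have : IsIso W.arrow := Subobject.isIso_iff_mk_eq_top _ |>.2 (by rw [Subobject.mk_arrow, htop])
  have hu : (1 : F') ⊗ₜ[F] 𝟙 X ∈ N.carrier X := by
    have := N.pull_mem (inv W.arrow) _ hW
    simpa using this
  obtain ⟨m, hm⟩ := hu
  -- A lift of the universal section to `Y` is a section of `Y.arrow`, which forces `Y = ⊤`.
  let s : (toScalarExtension F F' ht).obj X ⟶ (Y : ScalarExtension F F' A) :=
    ObjectProperty.homMk (IndModule.homOfSec _ m)
  have hs : s ≫ Y.arrow = 𝟙 _ := by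
    refine ObjectProperty.hom_ext _ (IndModule.extFunctor_hom_ext ?_)
    refine Eq.trans ?_ hm
    exact congrArg _ (IndModule.app_homOfSec_univSec _ m)
  rw [eq_top_iff]
  exact Subobject.le_of_comm ((⊤ : Subobject _).arrow ≫ s) (by
    rw [Category.assoc, hs, Category.comp_id])

end

/-! ### Semisimple objects -/

section

variable {C : Type u} [Category.{v} C] [Abelian C]

/-- A morphism from a semisimple object factors through any subobject of the target containing
all simple subobjects. -/
theorem IsSemisimpleObject.factors {X Y : C} (hX : IsSemisimpleObject X) (p : X ⟶ Y)
    (N : Subobject Y) (hN : ∀ S : Subobject Y, Simple (S : C) → S ≤ N) : N.Factors p := by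
  have hpb := Subobject.isPullback p N
  -- A simple subobject of `X` is either killed by `p` or embedded by it into `Y`; in both cases it
  -- lies in the preimage of `N`.
  have htop : (Subobject.pullback p).obj N = ⊤ := by
    refine hX _ fun T hT => ?_
    by_cases h0 : T.arrow ≫ p = 0
    · exact Subobject.le_of_comm (hpb.lift 0 T.arrow (by rw [h0, zero_comp])) (hpb.lift_snd _ _ _)
    · have : Mono (T.arrow ≫ p) := mono_of_nonzero_from_simple h0
      have hle := hN (Subobject.mk (T.arrow ≫ p)) (Simple.of_iso (Subobject.underlyingIso _))
      have hf : N.Factors (T.arrow ≫ p) := Subobject.factors_of_le _ hle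
        ((Subobject.mk_factors_iff _ _).2 (Subobject.mk_factors_self _))
      exact Subobject.le_of_comm (hpb.lift (N.factorThru _ hf) T.arrow (by simp))
        (hpb.lift_snd _ _ _)
  have : IsIso ((Subobject.pullback p).obj N).arrow :=
    (Subobject.isIso_iff_mk_eq_top _).2 (by rw [Subobject.mk_arrow, htop])
  have e : (inv ((Subobject.pullback p).obj N).arrow ≫ Subobject.pullbackπ p N) ≫ N.arrow = p := by
    rw [Category.assoc, hpb.w, IsIso.inv_hom_id_assoc]
  rw [← e]
  exact Subobject.factors_comp_arrow _

theorem IsSemisimpleObject.of_epi {X Y : C} (hX : IsSemisimpleObject X) (p : X ⟶ Y) [Epi p] :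
    IsSemisimpleObject Y := by
  intro N hN
  have hf := hX.factors p N hN
  have : Epi N.arrow := epi_of_epi_fac (N.factorThru_arrow p hf)
  have : IsIso N.arrow := isIso_of_mono_of_epi _
  exact Subobject.eq_top_of_isIso_arrow N

theorem IsSemisimpleObject.biprod {X Y : C} (hX : IsSemisimpleObject X)
    (hY : IsSemisimpleObject Y) : IsSemisimpleObject (X ⊞ Y) := by
  intro N hN
  have hi := hX.factors biprod.inl N hN
  have hj := hY.factors biprod.inr N hN
  have : biprod.desc (N.factorThru _ hi) (N.factorThru _ hj) ≫ N.arrow = 𝟙 (X ⊞ Y) := by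
    ext <;> simp
  have : Epi N.arrow := epi_of_epi_fac this
  have : IsIso N.arrow := isIso_of_mono_of_epi _
  exact Subobject.eq_top_of_isIso_arrow N

omit [Abelian C] in
theorem isSemisimpleObject_of_simple [HasZeroMorphisms C] (S : C) [Simple S] :
    IsSemisimpleObject S := by
  intro N hN
  have : Simple ((⊤ : Subobject S) : C) := Simple.of_iso (asIso (⊤ : Subobject S).arrow)
  exact top_le_iff.1 (hN ⊤ this)

omit [Abelian C] in
theorem isSemisimpleObject_of_isZero [HasZeroMorphisms C] {X : C} (hX : IsZero X) :
    IsSemisimpleObject X := fun _ _ =>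
  have := Subobject.subsingleton_of_isZero hX
  Subsingleton.elim _ _

end

/-! ### Ind-modules generated by a semisimple object -/

section

variable {F F' : Type v} [Field F] [Field F'] [Algebra F F']
  {A : Type u} [Category.{v} A] [Abelian A] [Linear F A]

/-- Divide `Y` by a maximal `W` on which `m` vanishes: by maximality, the induced section on the
quotient is nonzero on each simple subobject. -/
theorem exists_simple_sec (hA : IsFieldFinite F A) (M : IndModule F F' A) {Y : A} (m : M.Sec Y)
    (hm : m ≠ 0) : ∃ S : A, Simple S ∧ ∃ s : M.Sec S, s ≠ 0 := by
  have := (hA Y).1.1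
  obtain ⟨W, hW, hmax⟩ := WellFounded.has_min (wellFounded_gt (α := Subobject Y))
    {W : Subobject Y | M.res W.arrow m = 0} ⟨⊥, by
      rw [Set.mem_ofPred_eq, Subobject.bot_arrow, M.res_zero]⟩
  obtain ⟨m', rfl⟩ := M.exists_res_eq (cokernel.π W.arrow) m (by
    rw [← Abelian.monoLift_comp W.arrow (kernel.ι (cokernel.π W.arrow)) (kernel.condition _),
      M.res_comp]
    exact (congrArg _ hW).trans (map_zero _))
  have hQ : ¬IsZero (cokernel W.arrow) := fun hQ => hm (by
    rw [hQ.eq_of_tgt (cokernel.π W.arrow) 0, M.res_zero])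
  have := (hA (cokernel W.arrow)).1.2
  obtain ⟨S, hS⟩ := exists_simple_subobject hQ
  refine ⟨S, hS, M.res S.arrow m', fun h0 => hmax _ ?_ (lt_pullback_cokernel_π W S)⟩
  rw [Set.mem_ofPred_eq, ← M.res_comp, ← (Subobject.isPullback (cokernel.π W.arrow) S).w,
    M.res_comp, h0, map_zero]

/-- An ind-module is generated by a section over a semisimple object if morphisms from it are
determined by their values on that section. -/
def IsSemisimplyGenerated (U : IndModule F F' A) : Prop :=
  ∃ X : A, IsSemisimpleObject X ∧ ∃ u : U.Sec X, ∀ (G : IndModule F F' A) (a b : U ⟶ G),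
    IndModule.app a X u = IndModule.app b X u → a = b

theorem IsSemisimplyGenerated.of_epi {U U' : IndModule F F' A} (h : IsSemisimplyGenerated U)
    (q : U ⟶ U') [Epi q] : IsSemisimplyGenerated U' := by
  obtain ⟨X, hX, u, hu⟩ := h
  exact ⟨X, hX, IndModule.app q X u, fun G a b hab => (cancel_epi q).1 (hu G _ _ hab)⟩

theorem IsSemisimplyGenerated.prod {U U' : IndModule F F' A} (h : IsSemisimplyGenerated U)
    (h' : IsSemisimplyGenerated U') : IsSemisimplyGenerated (IndModule.prod U U') := by
  obtain ⟨X, hX, u, hu⟩ := h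
  obtain ⟨X', hX', u', hu'⟩ := h'
  -- The pair `(u, u')` over the biproduct; restriction along the two inclusions recovers both
  -- generators.
  let w : (IndModule.prod U U').Sec (X ⊞ X') :=
    IndModule.app IndModule.prodInl _ (U.res biprod.fst u) +
      IndModule.app IndModule.prodInr _ (U'.res biprod.snd u')
  have hw : (IndModule.prod U U').res biprod.inl w = IndModule.app IndModule.prodInl _ u := by
    rw [map_add, ← IndModule.app_res, ← IndModule.app_res, ← U.res_comp, ← U'.res_comp,
      biprod.inl_fst, biprod.inl_snd, U.res_id, U'.res_zero, map_zero, add_zero]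
  have hw' : (IndModule.prod U U').res biprod.inr w = IndModule.app IndModule.prodInr _ u' := by
    rw [map_add, ← IndModule.app_res, ← IndModule.app_res, ← U.res_comp, ← U'.res_comp,
      biprod.inr_fst, biprod.inr_snd, U.res_zero, U'.res_id, map_zero, zero_add]
  refine ⟨X ⊞ X', hX.biprod hX', w, fun G a b hab => IndModule.prod_hom_ext (hu _ _ _ ?_)
    (hu' _ _ _ ?_)⟩
  · rw [IndModule.app_comp, IndModule.app_comp, ← hw, IndModule.app_res, IndModule.app_res, hab]
  · rw [IndModule.app_comp, IndModule.app_comp, ← hw', IndModule.app_res, IndModule.app_res, hab]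

/-- The kernel of the identity serves as the zero module and starts the maximality argument below.
-/
theorem isSemisimplyGenerated_ker_id (M : IndModule F F' A) :
    IsSemisimplyGenerated (IndModule.ker (𝟙 M)) := by
  have hz {Y : A} (m : (IndModule.ker (𝟙 M)).Sec Y) : m = 0 :=
    Subtype.ext ((IndModule.exists_kerι_eq (𝟙 M) m.1).1 ⟨m, rfl⟩)
  refine ⟨_, isSemisimpleObject_of_isZero (isZero_zero A), 0, fun G a b _ => ?_⟩
  exact IndModule.ext_app fun Y m => by rw [hz m, map_zero, map_zero]

/-- Take a nonzero section over a simple object. If `a` and `b` agree on it, the kernel of `a - b`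
is a nonzero subobject of `T`, hence all of `T`. -/
theorem isSemisimplyGenerated_of_simple (hA : IsFieldFinite F A) (T : ScalarExtension F F' A)
    [Simple T] : IsSemisimplyGenerated T.obj := by
  obtain ⟨Y, m, hm⟩ : ∃ (Y : A) (m : T.obj.Sec Y), m ≠ 0 := by
    by_contra! h
    refine id_nonzero T (ObjectProperty.hom_ext _ (IndModule.ext_app fun Y m => ?_))
    exact h Y m
  obtain ⟨S, _, s, hs⟩ := exists_simple_sec hA T.obj m hm
  refine ⟨S, isSemisimpleObject_of_simple S, s, fun G a b hab => ?_⟩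
  have hinj := IndModule.kerι_injective (a - b)
  have := IndModule.mono_of_injective _ hinj
  let K : ScalarExtension F F' A :=
    ⟨IndModule.ker (a - b), T.property.of_mono (IndModule.kerι (a - b))⟩
  let j : K ⟶ T := ObjectProperty.homMk (IndModule.kerι (a - b))
  have : Mono j := ScalarExtension.mono_of_injective j hinj
  have hj : j ≠ 0 := by
    intro h0
    obtain ⟨y, hy⟩ := (IndModule.exists_kerι_eq (a - b) s).2 (by
      rw [IndModule.app_sub, hab, sub_self])
    exact hs (hy.symm.trans (congrArg (fun ψ : K ⟶ T => IndModule.app ψ.hom S y) h0))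
  have := isIso_of_mono_of_nonzero hj
  refine IndModule.ext_app fun Z z => ?_
  rw [← sub_eq_zero, ← IndModule.app_sub, ← IndModule.exists_kerι_eq]
  exact ⟨IndModule.app (inv j).hom Z z,
    congrArg (fun ψ : T ⟶ T => IndModule.app ψ.hom Z z) (IsIso.inv_hom_id j)⟩

/-- A maximal semisimply generated subobject `U` contains each simple `T`: either `T` meets `U`
trivially and `T ⊕ U` embeds in `M`, contradicting maximality unless `T ≤ U`, or the intersection is
`T`. -/
theorem isSemisimplyGenerated_of_isSemisimpleObject (hA : IsFieldFinite F A)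
    (ht : ∀ X : A, HasFiniteLength ((extFunctor F F').obj X))
    {M : ScalarExtension F F' A} (hM : IsSemisimpleObject M) :
    IsSemisimplyGenerated M.obj := by
  have := M.property.1
  have hz := IndModule.mono_of_injective _ (IndModule.kerι_injective (𝟙 M.obj))
  obtain ⟨U, hU, hmax⟩ := WellFounded.has_min (wellFounded_gt (α := Subobject M.obj))
    {U : Subobject M.obj | IsSemisimplyGenerated (U : IndModule F F' A)}
    ⟨Subobject.mk (IndModule.kerι (𝟙 M.obj)),
      (isSemisimplyGenerated_ker_id M.obj).of_epi (Subobject.underlyingIso _).inv⟩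
  have hUinj := IndModule.app_injective_of_mono U.arrow
  let U' : ScalarExtension F F' A := ⟨(U : IndModule F F' A), M.property.of_mono U.arrow⟩
  let i : U' ⟶ M := ObjectProperty.homMk U.arrow
  have hi : Mono i := ScalarExtension.mono_of_injective i hUinj
  have htop : Subobject.mk i = ⊤ := by
    refine hM _ fun T hT => ?_
    suffices ∃ g : (T : ScalarExtension F F' A).obj ⟶ (U : IndModule F F' A),
        g ≫ U.arrow = T.arrow.hom by
      obtain ⟨g, hg⟩ := this
      exact Subobject.le_mk_of_comm (ObjectProperty.homMk g) (ObjectProperty.hom_ext _ hg)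
    have hTinj (Y : A) : Function.Injective (IndModule.app T.arrow.hom Y) :=
      ScalarExtension.app_injective_of_mono ht T.arrow Y
    -- The kernel of the sum map is the intersection of `T` and `U`, embedded antidiagonally; this
    -- is the source of the minus sign in the last case.
    let f : IndModule.prod (T : ScalarExtension F F' A).obj (U : IndModule F F' A) ⟶ M.obj :=
      IndModule.prodFst ≫ T.arrow.hom + IndModule.prodSnd ≫ U.arrow
    let α : IndModule.ker f ⟶ (T : ScalarExtension F F' A).obj :=
      IndModule.kerι f ≫ IndModule.prodFst
    have hker {Y : A} (x : (IndModule.ker f).Sec Y) :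
        IndModule.app T.arrow.hom Y (IndModule.app α Y x) +
          IndModule.app U.arrow Y
            (IndModule.app (IndModule.kerι f ≫ IndModule.prodSnd) Y x) = 0 :=
      (IndModule.exists_kerι_eq f _).1 ⟨x, rfl⟩
    have hαinj (Y : A) : Function.Injective (IndModule.app α Y) := by
      refine (injective_iff_map_eq_zero _).2 fun x hx => IndModule.kerι_injective f Y ?_
      have h := hker x
      rw [hx, map_zero, zero_add] at h
      exact Prod.ext hx (hUinj Y (h.trans (map_zero _).symm))
    have := IndModule.mono_of_injective α hαinj
    let K : ScalarExtension F F' A :=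
      ⟨IndModule.ker f, (T : ScalarExtension F F' A).property.of_mono α⟩
    let j : K ⟶ (T : ScalarExtension F F' A) := ObjectProperty.homMk α
    have : Mono j := ScalarExtension.mono_of_injective j hαinj
    by_cases hj : j = 0
    · have hfinj (Y : A) : Function.Injective (IndModule.app f Y) := by
        refine (injective_iff_map_eq_zero _).2 fun x hx => ?_
        obtain ⟨y, rfl⟩ := (IndModule.exists_kerι_eq f x).2 hx
        have : y = 0 := hαinj Y
          ((congrArg (fun ψ : K ⟶ (T : ScalarExtension F F' A) => IndModule.app ψ.hom Y y) hj).trans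
            (map_zero (IndModule.app α Y)).symm)
        rw [this, map_zero]
      have := IndModule.mono_of_injective f hfinj
      have hinl : IndModule.prodInl ≫ f = T.arrow.hom := IndModule.ext_app fun Y m =>
        (congrArg (IndModule.app T.arrow.hom Y m + ·) (map_zero (IndModule.app U.arrow Y))).trans
          (add_zero _)
      have hinr : IndModule.prodInr ≫ f = U.arrow := IndModule.ext_app fun Y m =>
        (congrArg (· + IndModule.app U.arrow Y m) (map_zero (IndModule.app T.arrow.hom Y))).trans
          (zero_add _)
      have hgen : IsSemisimplyGenerated (Subobject.mk f : IndModule F F' A) :=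
        ((isSemisimplyGenerated_of_simple hA (T : ScalarExtension F F' A)).prod hU).of_epi
          (Subobject.underlyingIso f).inv
      have hle : U ≤ Subobject.mk f := Subobject.le_mk_of_comm IndModule.prodInr hinr
      have heq : Subobject.mk f ≤ U := by
        by_contra hlt
        exact hmax _ hgen ⟨hle, hlt⟩
      exact ⟨IndModule.prodInl ≫ Subobject.ofMkLE f U heq, by
        rw [Category.assoc, Subobject.ofMkLE_arrow, hinl]⟩
    · have := isIso_of_mono_of_nonzero hj
      refine ⟨-((inv j).hom ≫ IndModule.kerι f ≫ IndModule.prodSnd), ?_⟩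
      refine IndModule.ext_app fun Y m => ?_
      have h := hker (IndModule.app (inv j).hom Y m)
      have h1 : IndModule.app α Y (IndModule.app (inv j).hom Y m) = m :=
        congrArg (fun ψ : (T : ScalarExtension F F' A) ⟶ T => IndModule.app ψ.hom Y m)
          (IsIso.inv_hom_id j)
      rw [h1] at h
      rw [IndModule.app_comp, IndModule.app_neg, map_neg]
      exact (eq_neg_of_add_eq_zero_left h).symm
  have : IsIso i := (Subobject.isIso_iff_mk_eq_top i).2 htop
  have : IsIso U.arrow := inferInstanceAs (IsIso ((ObjectProperty.ι _).map i))
  exact IsSemisimplyGenerated.of_epi hU U.arrow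

/-- The generating section corresponds by Yoneda to `F' ⊗ X ⟶ M`, and determining morphisms by that
section says that it is epi. -/
theorem exists_epi_of_isSemisimpleObject (hA : IsFieldFinite F A)
    (ht : ∀ X : A, HasFiniteLength ((extFunctor F F').obj X))
    {M : ScalarExtension F F' A} (hM : IsSemisimpleObject M) :
    ∃ (X : A) (φ : (toScalarExtension F F' ht).obj X ⟶ M), IsSemisimpleObject X ∧ Epi φ := by
  obtain ⟨X, hX, u, hu⟩ := isSemisimplyGenerated_of_isSemisimpleObject hA ht hM
  refine ⟨X, ObjectProperty.homMk (M.obj.homOfSec u), hX, ⟨fun a b h => ?_⟩⟩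
  refine ObjectProperty.hom_ext _ (hu _ _ _ ?_)
  rw [← M.obj.app_homOfSec_univSec u]
  exact congrArg (fun ψ => IndModule.app ψ.hom X (IndModule.univSec F F' X)) h

end

end ScalarExt

end

/-! ### The comparison of `V` and `V'` -/

theorem mainTheorem8 {F F' : Type v} [Field F] [Field F'] [Algebra F F']
    (hF' : ScalarExt.IsSeparableExtension F F')
    {A : Type u} [Category.{v} A] [Abelian A] [Linear F A] (hA : ScalarExt.IsFieldFinite F A)
    {B : Type u₁} [Category.{v₁} B] [Abelian B] [Linear F' B]
    (V : A ⥤ B) (hV : PreservesFiniteColimits V) (hVlin : ScalarExt.IsLinearOver F F' V) :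
    ∃ ht : ∀ X : A, ScalarExt.HasFiniteLength ((ScalarExt.extFunctor F F').obj X),
      ∀ V' : ScalarExt.ScalarExtension F F' A ⥤ B,
        PreservesFiniteColimits V' → ScalarExt.IsLinearOver F' F' V' →
        Nonempty (V ≅ ScalarExt.toScalarExtension F F' ht ⋙ V') →
        (ScalarExt.IsSemisimpleOnObjects V ↔ ScalarExt.IsSemisimpleOnObjects V') := by
  have ht (X : A) : ScalarExt.HasFiniteLength ((ScalarExt.extFunctor F F').obj X) :=
    ScalarExt.hasFiniteLength_of_hasRank (ScalarExt.hasRank_of_isFieldFinite hA X)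
  refine ⟨ht, fun V' _ _ ⟨e⟩ => ⟨fun h M hM => ?_, fun h X hX => ?_⟩⟩
  · obtain ⟨X, φ, hX, hφ⟩ := ScalarExt.exists_epi_of_isSemisimpleObject hA ht hM
    have : Epi (V'.map φ) := preserves_epi_of_preservesColimit V' φ
    exact ((h X hX).of_epi (e.hom.app X)).of_epi (V'.map φ)
  · exact (h _ (ScalarExt.isSemisimpleObject_toScalarExtension hF' hA ht hX)).of_epi
      (e.inv.app X)
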